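/- Let $\mu\ge 0$, $L>0$, $B^2=\{(x,y)\in\mathbb R^2: x^2+y^2\le 1\}$, $B_L=B^2\times[0,L]$. Put $W_\mu(x,y)=(1-x^2-y^2)^{\mu-1/2}$ and $a_\mu=(\mu+\tfrac12)/\pi$ (so that $a_\mu\int_{B^2}W_\mu=1$), let $W_L\ge 0$ be an integrable weight function on $[0,L]$ with $\int_0^L W_L>0$, and let $W_{\mu,L}(x,y,z)=W_\mu(x,y)W_L(z)$. For $k\ge 0$ let $\mathcal V_k^2(W_\mu)$ be the space of real polynomials in two variables of total degree at most $k$ that are orthogonal, with respect to $\langle P,Q\rangle_\mu=a_\mu\int_{B^2}PQ\,W_\mu\,dx\,dy$, to all polynomials of total degree less than $k$. Let $\{P^k_j:0\le j\le k\}$ be any orthonormal basis of $\mathcal V^2_k(W_\mu)$, and let $p_k$ ($k\ge0$) be polynomials of degree $k$ that are orthonormal with respect to $W_L$, i.e. $\int_0^L p_ip_jW_L\,dz=\delta_{i,j}$. Put $P_{l,k,j}(x,y,z)=P_j^k(x,y)\,p_{l-k}(z)$ for $0\le j\le k\le l$. For $f\in L^2(W_{\mu,L};B_L)$ let $$\widehat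 f_{l,k,j}=a_\mu\int_{B_L} f\,P_{l,k,j}\,W_{\mu,L}\,dx\,dy\,dz,\qquad S^\mu_{n,L}f=\sum_{l=0}^n\sum_{k=0}^l\sum_{j=0}^k\widehat f_{l,k,j}\,P_{l,k,j}.$$ For $g:B^2\to\mathbb R$ the attenuated Radon projection is the line integral $$\mathcal R^\mu_\theta(g;t)=\int_{-\sqrt{1-t^2}}^{\sqrt{1-t^2}}(g\,W_\mu)(t\cos\theta-s\sin\theta,\;t\sin\theta+s\cos\theta)\,ds,\qquad -1\le t\le 1 .$$ Let $(c)_m=c(c+1)\cdots(c+m-1)$, and let $C_k^{\lambda}$ denote the Gegenbauer polynomials, $C_k^\lambda(t)=\sum_{0\le 2j\le k}(-1)^j\frac{(\lambda)_{k-j}}{j!\,(k-2j)!}(2t)^{k-2j}$. Let $p_l^{(\alpha,\beta)}$ denote the Jacobi polynomial of degree $l$, orthonormal on $[-1,1]$ with respect to the weight $(1-t)^\alpha(1+t)^\beta$ normalized to have integral $1$ and with positive leading coefficient. In polar coordinates $x=r\cos\phi$, $y=r\sin\phi$ put, for $0\le 2l\le k$ and $\varepsilon\in\{0,1\}$, $$P_{l,\varepsilon}^k(x,y)=h_{l,k}\,p_l^{(\mu-\frac12,k-2l)}(2r^2-1)\,r^{k-2l}S_{k-2l,\varepsilon}(\phi),\qquad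 S_{m,0}(\phi)=\cos m\phi,\quad S_{m,1}(\phi)=\sin m\phi,$$ $$h_{l,k}=\left[\kappa_{l,k}\,\frac{\Gamma(k-2l+\mu+\frac32)}{\Gamma(\mu+\frac32)\,\Gamma(k-2l+1)}\right]^{1/2},\qquad \kappa_{l,k}=\begin{cases}2,&2l<k,\\1,&2l=k,\end{cases}$$ and $$\lambda^\mu_{l,k}=\left[\frac{(\mu+\frac12)_l\,(\mu+\frac32)_{k-l}\,(k+\mu+\frac12)}{l!\,(k-l)!\,(k-l+\mu+\frac12)}\right]^{-1}.$$ Define $$D_k^{\mu+1/2}(\xi;x,y)=\sum_{0\le 2l\le k}\ \sum_{\varepsilon=0,1}\lambda^\mu_{l,k}\,P^k_{l,\varepsilon}(\cos\xi,\sin\xi)\,P^k_{l,\varepsilon}(x,y),$$ $$\Phi_n^\mu(\xi,w,t;\mathbf x)=\sum_{k=0}^n\frac{k+\mu+\frac12}{\mu+\frac12}\,C_k^{\mu+1/2}(t)\,D_k^{\mu+1/2}(\xi;x_1,x_2)\sum_{l=0}^{n-k}p_l(w)\,p_l(x_3).$$ Then for every $n\ge 0$, every $f\in L^2(W_{\mu,L};B_L)$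 and every $\mathbf x=(x_1,x_2,x_3)\in\mathbb R^3$ (in particular, every $\mathbf x\in B_L$), with $\xi_\nu=\frac{\nu\pi}{n+1}$, $$S^\mu_{n,L}f(\mathbf x)=\frac1{n+1}\sum_{\nu=0}^n a_\mu\int_{-1}^1\int_0^L\mathcal R^\mu_{\xi_\nu}\bigl(f(\cdot,\cdot,w);t\bigr)\,\Phi^\mu_n(\xi_\nu,w,t;\mathbf x)\,W_L(w)\,dw\,dt .$$ -/

import Mathlib

open MeasureTheory

noncomputable section

namespace CylinderRadon

/-- The closed unit disk `B²`. -/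
def disk : Set (ℝ × ℝ) := {q | q.1 ^ 2 + q.2 ^ 2 ≤ 1}

/-- The cylinder `B_L = B² × [0, L]`. -/
def cylinder (L : ℝ) : Set (ℝ × ℝ × ℝ) :=
  {q | q.1 ^ 2 + q.2.1 ^ 2 ≤ 1 ∧ 0 ≤ q.2.2 ∧ q.2.2 ≤ L}

/-- The weight `W_μ(x, y) = (1 - x² - y²) ^ (μ - 1/2)` on the disk. -/
def diskWeight (μ x y : ℝ) : ℝ := (1 - x ^ 2 - y ^ 2) ^ (μ - 1 / 2)

/-- The normalization constant `a_μ = (μ + 1/2) / π` of `W_μ`. -/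
def a (μ : ℝ) : ℝ := (μ + 1 / 2) / Real.pi

/-- A weight function on `[0, L]`: nonnegative, integrable, with positive integral. -/
structure IsWeight (L : ℝ) (WL : ℝ → ℝ) : Prop where
  nonneg : ∀ z ∈ Set.Icc 0 L, 0 ≤ WL z
  integrable : IntegrableOn WL (Set.Icc 0 L)
  integral_pos : 0 < ∫ z in (0 : ℝ)..L, WL z

/-- The product weight `W_{μ,L}(x, y, z) = W_μ(x, y) W_L(z)`. -/
def cylinderWeight (μ : ℝ) (WL : ℝ → ℝ) (q : ℝ × ℝ × ℝ) : ℝ :=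
  diskWeight μ q.1 q.2.1 * WL q.2.2

/-- The measure `W_{μ,L}(x) dx` on the cylinder; `L²(W_{μ,L}; B_L)` is `MemLp · 2` of it. -/
def cylinderMeasure (μ L : ℝ) (WL : ℝ → ℝ) : Measure (ℝ × ℝ × ℝ) :=
  (volume.restrict (cylinder L)).withDensity
    (fun q => ENNReal.ofReal (cylinderWeight μ WL q))

/-- The inner product `⟨P, Q⟩_μ = a_μ ∫_{B²} P Q W_μ dx dy` of polynomials in two variables. -/
def diskInner (μ : ℝ) (P Q : MvPolynomial (Fin 2) ℝ) : ℝ :=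
  a μ * ∫ q in disk,
    MvPolynomial.eval ![q.1, q.2] P * MvPolynomial.eval ![q.1, q.2] Q * diskWeight μ q.1 q.2

/-- The space `V_k²(W_μ)` of orthogonal polynomials of degree `k`: polynomials of total degree at
most `k` that are orthogonal to all polynomials of degree at most `k - 1`. -/
def orthPoly (μ : ℝ) (k : ℕ) : Set (MvPolynomial (Fin 2) ℝ) :=
  {P | P.totalDegree ≤ k ∧
    ∀ Q : MvPolynomial (Fin 2) ℝ, Q.totalDegree < k → diskInner μ P Q = 0}

/-- `P 0, …, P k` is an orthonormal basis of `V_k²(W_μ)`. -/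
structure IsOrthonormalBasis (μ : ℝ) (k : ℕ) (P : Fin (k + 1) → MvPolynomial (Fin 2) ℝ) :
    Prop where
  mem : ∀ j, P j ∈ orthPoly μ k
  orthonormal : ∀ i j, diskInner μ (P i) (P j) = if i = j then 1 else 0
  span : ∀ Q ∈ orthPoly μ k, Q ∈ Submodule.span ℝ (Set.range P)

/-- `p 0, p 1, …` are the orthonormal polynomials with respect to the weight `W_L` on `[0, L]`
(each of them is determined up to its sign). -/
structure IsOrthonormalPolys (L : ℝ) (WL : ℝ → ℝ) (p : ℕ → Polynomial ℝ) : Prop where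
  natDegree_eq : ∀ k, (p k).natDegree = k
  orthonormal : ∀ i j,
    ∫ z in (0 : ℝ)..L, (p i).eval z * (p j).eval z * WL z = if i = j then 1 else 0

/-- The polynomial `P_{l,k,j}(x, y, z) = P_j^k(x, y) p_{l-k}(z)`, for `k ≤ l`. -/
def cylinderPoly (P : (k : ℕ) → Fin (k + 1) → MvPolynomial (Fin 2) ℝ) (p : ℕ → Polynomial ℝ)
    (l k : ℕ) (j : Fin (k + 1)) (q : ℝ × ℝ × ℝ) : ℝ :=
  MvPolynomial.eval ![q.1, q.2.1] (P k j) * (p (l - k)).eval q.2.2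

/-- The Fourier coefficient `a_μ ∫_{B_L} f P_{l,k,j} W_{μ,L} dx`. -/
def fourierCoeff (μ L : ℝ) (WL : ℝ → ℝ) (P : (k : ℕ) → Fin (k + 1) → MvPolynomial (Fin 2) ℝ)
    (p : ℕ → Polynomial ℝ) (f : ℝ × ℝ × ℝ → ℝ) (l k : ℕ) (j : Fin (k + 1)) : ℝ :=
  a μ * ∫ q in cylinder L, f q * cylinderPoly P p l k j q * cylinderWeight μ WL q

/-- The Fourier partial sum `S_{n,L}^μ f`. -/
def partialSum (μ L : ℝ) (WL : ℝ → ℝ) (P : (k : ℕ) → Fin (k + 1) → MvPolynomial (Fin 2) ℝ)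
    (p : ℕ → Polynomial ℝ) (n : ℕ) (f : ℝ × ℝ × ℝ → ℝ) (x : ℝ × ℝ × ℝ) : ℝ :=
  ∑ l ∈ Finset.range (n + 1), ∑ k ∈ Finset.range (l + 1), ∑ j : Fin (k + 1),
    fourierCoeff μ L WL P p f l k j * cylinderPoly P p l k j x

/-- The attenuated Radon projection `R_θ^μ(g; t)`: the integral of `g W_μ` with respect to arc
length over the segment `{x cos θ + y sin θ = t} ∩ B²`, parametrized by
`s ↦ (t cos θ - s sin θ, t sin θ + s cos θ)`, `|s| ≤ √(1 - t²)`. -/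
def radon (μ θ : ℝ) (g : ℝ × ℝ → ℝ) (t : ℝ) : ℝ :=
  ∫ s in (-Real.sqrt (1 - t ^ 2))..(Real.sqrt (1 - t ^ 2)),
    g (t * Real.cos θ - s * Real.sin θ, t * Real.sin θ + s * Real.cos θ) *
      diskWeight μ (t * Real.cos θ - s * Real.sin θ) (t * Real.sin θ + s * Real.cos θ)

/-- The Pochhammer symbol `(c)_n = c (c + 1) ⋯ (c + n - 1)`. -/
def poch (c : ℝ) (n : ℕ) : ℝ := (ascPochhammer ℝ n).eval c

/-- The Gegenbauer polynomial
`C_n^lam(t) = ∑_{2j ≤ n} (-1)^j (lam)_{n-j} / (j! (n-2j)!) (2t)^{n-2j}`. -/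
def gegenbauer (lam : ℝ) (n : ℕ) (t : ℝ) : ℝ :=
  ∑ j ∈ Finset.range (n / 2 + 1),
    (-1) ^ j * poch lam (n - j) / ((j.factorial : ℝ) * ((n - 2 * j).factorial : ℝ)) *
      (2 * t) ^ (n - 2 * j)

/-- The Jacobi polynomial in its standard normalization,
`P_n^{(α,β)}(t) = ∑_{m ≤ n} (n+α+β+1)_m (α+m+1)_{n-m} / (m! (n-m)!) ((t-1)/2)^m`. -/
def jacobi (α β : ℝ) (n : ℕ) (t : ℝ) : ℝ :=
  ∑ m ∈ Finset.range (n + 1),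
    poch (n + α + β + 1) m * poch (α + m + 1) (n - m) /
      ((m.factorial : ℝ) * ((n - m).factorial : ℝ)) * ((t - 1) / 2) ^ m

/-- The Jacobi weight `(1 - t)^α (1 + t)^β` on `[-1, 1]`. -/
def jacobiWeight (α β t : ℝ) : ℝ := (1 - t) ^ α * (1 + t) ^ β

/-- The orthonormal Jacobi polynomial `p_n^{(α,β)}`, with respect to the Jacobi weight normalized
to have integral `1` on `[-1, 1]`. -/
def jacobiOrthonormal (α β : ℝ) (n : ℕ) (t : ℝ) : ℝ :=
  jacobi α β n t / Real.sqrt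
    ((∫ u in (-1 : ℝ)..1, jacobi α β n u ^ 2 * jacobiWeight α β u) /
      ∫ u in (-1 : ℝ)..1, jacobiWeight α β u)

/-- `r^m S_{m,ε}(φ)` for `x + i y = r e^{iφ}`, that is, `r^m cos (m φ)` for `ε = 0` and
`r^m sin (m φ)` for `ε = 1`. -/
def solid (m : ℕ) (ε : Fin 2) (x y : ℝ) : ℝ :=
  if ε = 0 then ((⟨x, y⟩ : ℂ) ^ m).re else ((⟨x, y⟩ : ℂ) ^ m).im

/-- The constant `h_{l,k}` that makes the polynomials `polarPoly` orthonormal. -/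
def h (μ : ℝ) (l k : ℕ) : ℝ :=
  Real.sqrt ((if 2 * l < k then 2 else 1) *
    (Real.Gamma ((k - 2 * l : ℕ) + μ + 3 / 2) /
      (Real.Gamma (μ + 3 / 2) * Real.Gamma ((k - 2 * l : ℕ) + 1))))

/-- The orthonormal basis of `V_k²(W_μ)` in polar coordinates `x + i y = r e^{iφ}`,
`P_{l,ε}^k(x, y) = h_{l,k} p_l^{(μ-1/2, k-2l)}(2r² - 1) r^{k-2l} S_{k-2l,ε}(φ)`, where
`0 ≤ 2l ≤ k` for `ε = 0` and `0 ≤ 2l ≤ k - 1` for `ε = 1` (it is zero for `ε = 1`, `2l = k`). -/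
def polarPoly (μ : ℝ) (k l : ℕ) (ε : Fin 2) (x y : ℝ) : ℝ :=
  h μ l k * jacobiOrthonormal (μ - 1 / 2) ((k - 2 * l : ℕ) : ℝ) l (2 * (x ^ 2 + y ^ 2) - 1) *
    solid (k - 2 * l) ε x y

/-- The constant `λ_{l,k}^μ`, the reciprocal of
`(μ+1/2)_l (μ+3/2)_{k-l} (k+μ+1/2) / (l! (k-l)! (k-l+μ+1/2))`. -/
def lambda (μ : ℝ) (l k : ℕ) : ℝ :=
  (poch (μ + 1 / 2) l * poch (μ + 3 / 2) (k - l) * (k + μ + 1 / 2) /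
    ((l.factorial : ℝ) * ((k - l).factorial : ℝ) * ((k - l : ℕ) + μ + 1 / 2)))⁻¹

/-- `D_k^{μ+1/2}(ξ; x, y)`, the sum over the basis of
`λ_{l,k} P_{l,ε}^k(cos ξ, sin ξ) P_{l,ε}^k(x, y)`. -/
def kernelD (μ : ℝ) (k : ℕ) (ξ x y : ℝ) : ℝ :=
  ∑ l ∈ Finset.range (k / 2 + 1), ∑ ε : Fin 2,
    lambda μ l k * polarPoly μ k l ε (Real.cos ξ) (Real.sin ξ) * polarPoly μ k l ε x y

/-- `D_k^{μ+1/2}(ξ, t; x, y) = (k+μ+1/2)/(μ+1/2) C_k^{μ+1/2}(t) D_k^{μ+1/2}(ξ; x, y)`. -/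
def kernelDt (μ : ℝ) (k : ℕ) (ξ t x y : ℝ) : ℝ :=
  (k + μ + 1 / 2) / (μ + 1 / 2) * gegenbauer (μ + 1 / 2) k t * kernelD μ k ξ x y

/-- The kernel
`Φ_n^μ(ξ, w, t; x) = ∑_{k ≤ n} D_k^{μ+1/2}(ξ, t; x₁, x₂) ∑_{l ≤ n-k} p_l(w) p_l(x₃)`. -/
def Phi (μ : ℝ) (p : ℕ → Polynomial ℝ) (n : ℕ) (ξ w t : ℝ) (x : ℝ × ℝ × ℝ) : ℝ :=
  ∑ k ∈ Finset.range (n + 1), kernelDt μ k ξ t x.1 x.2.1 *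
    ∑ l ∈ Finset.range (n - k + 1), (p l).eval w * (p l).eval x.2.2

/-- The angles `ξ_ν = ν π / (n + 1)`. -/
def angle (n ν : ℕ) : ℝ := ν * Real.pi / (n + 1)

end CylinderRadon

end

noncomputable section

namespace CylinderRadon

/-! ### Pochhammer symbols -/

/-! Both sides are integrals of `f` times the weight against a kernel, and the proof shows that the
two kernels agree pointwise. On the left, interchanging the finite sums with the integral
(`partialSum_eq_integral`, `sum_cylinderPoly`) gives the sum over `k ≤ n` of the reproducing kernel
of `orthPoly μ k` times `∑ l ≤ n - k` of `p l (w) * p l (x₃)`. On the right, rotating the disk by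
`ξ_ν` and applying Fubini (`integral_radon`) turns the integral of a Radon projection against `Phi`
into an integral over the cylinder in which `t` becomes `y₁ cos ξ_ν + y₂ sin ξ_ν`. It remains to
show, for each `k ≤ n`, that averaging the ridge kernels `kernelDt` over the angles produces the
reproducing kernel (`IsOrthonormalBasis.sum_kernelDt`).

For this, the reproducing kernel does not depend on the orthonormal basis
(`IsOrthonormalBasis.sum_eval_mul_eval`), so the polar basis may be used. Its orthogonality and its
norms come from Jacobi moments, evaluated by Chu-Vandermonde. The Gegenbauer factor, as a ridge
function, expands in products of the same Jacobi polynomials and solid harmonics in the point and in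
the direction (`gegenbauer_ridge`). On the unit circle the Jacobi factor of a polar basis element is
evaluated at `1`, so its dependence on `ξ` is purely trigonometric. All frequencies `k - 2 l` have
the same parity and are at most `n`, so the `n + 1` angles in `[0, π)` integrate the products
exactly (`sum_solid_mul_solid`). Only diagonal terms survive, and `lambda` is the constant that
makes their coefficients equal to one (`lambda_mul`). -/

@[simp] lemma poch_zero (c : ℝ) : poch c 0 = 1 := by simp [poch]

lemma poch_succ (c : ℝ) (n : ℕ) : poch c (n + 1) = poch c n * (c + n) := by
  simp [poch, ascPochhammer_succ_eval]

lemma poch_succ_left (c : ℝ) (n : ℕ) : poch c (n + 1) = c * poch (c + 1) n := by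
  simp [poch, ascPochhammer_succ_left]

lemma poch_add (c : ℝ) (m n : ℕ) : poch c (m + n) = poch c m * poch (c + m) n := by
  induction n with
  | zero => simp
  | succ n ih => rw [← add_assoc, poch_succ, ih, poch_succ]; push_cast; ring

lemma poch_pos {c : ℝ} (hc : 0 < c) (n : ℕ) : 0 < poch c n := by
  induction n with
  | zero => simp
  | succ n ih => rw [poch_succ]; positivity

lemma poch_natCast_succ (a n : ℕ) : poch (a + 1 : ℝ) n = (a + n).factorial / a.factorial := by
  induction n with
  | zero => simp [Nat.factorial_ne_zero]
  | succ n ih =>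
    rw [poch_succ, ih, ← add_assoc, Nat.factorial_succ]
    push_cast; ring

lemma poch_one (n : ℕ) : poch 1 n = n.factorial := by
  simpa using poch_natCast_succ 0 n

lemma poch_eq_prod (c : ℝ) (n : ℕ) : poch c n = ∏ j ∈ Finset.range n, (c + j) := by
  induction n with
  | zero => simp
  | succ n ih => rw [poch_succ, ih, Finset.prod_range_succ]

lemma poch_neg_eq_zero {c : ℝ} {b n : ℕ} (hb : b < n) (hc : c = -b) : poch c n = 0 := by
  rw [poch_eq_prod]
  exact Finset.prod_eq_zero (Finset.mem_range.2 hb) (by simp [hc])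

/-- The Chu-Vandermonde identity. -/
lemma sum_antidiagonal_choose_poch (x : ℝ) (n : ℕ) (c : ℝ) :
    ∑ ij ∈ Finset.HasAntidiagonal.antidiagonal n,
      (n.choose ij.1 : ℝ) * ((-1) ^ ij.1 * poch x ij.1 * poch (c + ij.1) ij.2) =
      poch (c - x) n := by
  induction n generalizing c with
  | zero => simp
  | succ n ih =>
    rw [Finset.sum_antidiagonal_choose_succ_mul
      (fun i j => (-1) ^ i * poch x i * poch (c + i) j), poch_succ_left,
      show c - x + 1 = c + 1 - x by ring, ← ih, Finset.mul_sum, ← Finset.sum_add_distrib]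
    -- Pascal's rule leaves two terms with a common factor; the remaining factors combine as `(c +
    -- i) - (x + i) = c - x`.
    refine Finset.sum_congr rfl fun ij hij => ?_
    have hn : n.choose ij.2 = n.choose ij.1 :=
      (Nat.choose_symm_of_eq_add (Finset.HasAntidiagonal.mem_antidiagonal.1 hij).symm).symm
    rw [hn, poch_succ_left, poch_succ]
    push_cast
    rw [show c + (ij.1 : ℝ) + 1 = c + 1 + ij.1 by ring, show c + ((ij.1 : ℝ) + 1) = c + 1 + ij.1 by ring]
    ring

lemma sum_range_choose_poch (x c : ℝ) (n : ℕ) :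
    ∑ i ∈ Finset.range (n + 1),
      (-1) ^ i * poch x i * poch (c + i) (n - i) / ((i.factorial : ℝ) * ((n - i).factorial : ℝ)) =
      poch (c - x) n / n.factorial := by
  rw [← sum_antidiagonal_choose_poch, Finset.Nat.sum_antidiagonal_eq_sum_range_succ_mk,
    Finset.sum_div]
  refine Finset.sum_congr rfl fun i hi => ?_
  rw [Nat.cast_choose ℝ (by simpa [Nat.lt_succ_iff] using hi)]
  field_simp

/-! ### Jacobi polynomials -/

lemma jacobi_one (α β : ℝ) (n : ℕ) : jacobi α β n 1 = poch (α + 1) n / n.factorial := by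
  rw [jacobi, Finset.sum_eq_single 0]
  · simp
  · intro m _ hm; simp [hm]
  · simp

lemma jacobi_eq_sum_one_sub (α β : ℝ) (n : ℕ) (r : ℝ) :
    jacobi α β n (2 * r - 1) = ∑ m ∈ Finset.range (n + 1),
      (-1) ^ m * poch (n + α + β + 1) m * poch (α + m + 1) (n - m) /
        ((m.factorial : ℝ) * ((n - m).factorial : ℝ)) * (1 - r) ^ m := by
  rw [jacobi]
  refine Finset.sum_congr rfl fun m _ => ?_
  rw [show (2 * r - 1 - 1) / 2 = (-1) * (1 - r) by ring, mul_pow]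
  ring

/-- The coefficient of `r ^ j` in the Jacobi polynomial of degree `n` at `2 r - 1`. -/
def jacobiCoeff (α β : ℝ) (n j : ℕ) : ℝ :=
  (-1) ^ (n - j) * poch (n + α + β + 1) j * poch (β + j + 1) (n - j) /
    ((j.factorial : ℝ) * ((n - j).factorial : ℝ))

/-- Reflection of the Pochhammer symbol. -/
lemma poch_neg_reflect (c : ℝ) (n : ℕ) : poch (-c - n + 1) n = (-1) ^ n * poch c n := by
  have h : (-1 : ℝ) ^ n = ∏ _j ∈ Finset.range n, (-1 : ℝ) := by simp
  rw [poch_eq_prod, poch_eq_prod, ← Finset.prod_range_reflect, h, ← Finset.prod_mul_distrib]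
  refine Finset.prod_congr rfl fun j hj => ?_
  have : j + 1 ≤ n := Finset.mem_range.1 hj
  rw [Nat.sub_sub, add_comm 1 j, Nat.cast_sub this]
  push_cast; ring

/-- Expanding each power of `r - 1` binomially and exchanging the triangular sum leaves, for each
power of `r`, a Chu-Vandermonde sum, whose value is then reflected. -/
lemma jacobi_eq_sum_pow (α β : ℝ) (n : ℕ) (r : ℝ) :
    jacobi α β n (2 * r - 1) = ∑ j ∈ Finset.range (n + 1), jacobiCoeff α β n j * r ^ j := by
  have key := Finset.sum_range_diag_flip (n + 1) (fun j i : ℕ =>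
    poch (n + α + β + 1) (j + i) * poch (α + (j + i : ℕ) + 1) (n - (j + i)) /
      ((j.factorial : ℝ) * (i.factorial : ℝ) * ((n - (j + i)).factorial : ℝ)) *
      ((-1) ^ i * r ^ j))
  have h1 : jacobi α β n (2 * r - 1) = ∑ m ∈ Finset.range (n + 1), ∑ j ∈ Finset.range (m + 1),
      poch (n + α + β + 1) (j + (m - j)) * poch (α + (j + (m - j) : ℕ) + 1) (n - (j + (m - j))) /
      ((j.factorial : ℝ) * ((m - j).factorial : ℝ) * ((n - (j + (m - j))).factorial : ℝ)) *
      ((-1) ^ (m - j) * r ^ j) := by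
    rw [jacobi]
    refine Finset.sum_congr rfl fun m _ => ?_
    rw [show (2 * r - 1 - 1) / 2 = r + (-1) by ring, add_pow, Finset.mul_sum]
    refine Finset.sum_congr rfl fun j hj => ?_
    have hj' : j ≤ m := Nat.lt_succ_iff.1 (Finset.mem_range.1 hj)
    rw [Nat.add_sub_cancel' hj', Nat.cast_choose ℝ hj']
    field_simp
  rw [h1, key]
  refine Finset.sum_congr rfl fun j hj => ?_
  have hj' : j ≤ n := Nat.lt_succ_iff.1 (Finset.mem_range.1 hj)
  have h2 := sum_range_choose_poch (n + α + β + 1 + j) (α + j + 1) (n - j)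
  have h3 : poch (α + j + 1 - (n + α + β + 1 + j)) (n - j) =
      (-1) ^ (n - j) * poch (β + j + 1) (n - j) := by
    rw [← poch_neg_reflect, Nat.cast_sub hj']; congr 1; ring
  rw [h3] at h2
  have h4 : jacobiCoeff α β n j * r ^ j = poch (n + α + β + 1) j / j.factorial * r ^ j *
      ((-1) ^ (n - j) * poch (β + j + 1) (n - j) / (n - j).factorial) := by
    rw [jacobiCoeff]; field_simp
  rw [h4, ← h2, Finset.mul_sum, show n + 1 - j = n - j + 1 by omega]
  refine Finset.sum_congr rfl fun i hi => ?_
  have e1 : (α + ((j + i : ℕ) : ℝ) + 1) = α + j + 1 + i := by push_cast; ring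
  rw [poch_add, Nat.sub_add_eq, e1]
  field_simp

/-! ### Ridge expansion of Gegenbauer polynomials -/

/-- Pairs `j` with `k - j`; the middle index of an even `k` is its own partner and is counted once.
-/
lemma sum_range_fold {M : Type*} [AddCommMonoid M] (k : ℕ) (g : ℕ → M) :
    ∑ j ∈ Finset.range (k + 1), g j =
      ∑ l ∈ Finset.range (k / 2 + 1), (g l + if 2 * l < k then g (k - l) else 0) := by
  rw [Finset.sum_add_distrib, ← Finset.sum_filter,
    ← Finset.sum_filter_add_sum_filter_not (Finset.range (k + 1)) (fun j => j < k / 2 + 1)]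
  congr 1
  · refine Finset.sum_congr ?_ fun _ _ => rfl
    ext j; simp only [Finset.mem_filter, Finset.mem_range]; omega
  · refine Finset.sum_nbij' (fun j => k - j) (fun j => k - j) ?_ ?_ ?_ ?_ ?_
    · intro j; simp only [Finset.mem_filter, Finset.mem_range]; omega
    · intro j; simp only [Finset.mem_filter, Finset.mem_range]; omega
    · intro j; simp only [Finset.mem_filter, Finset.mem_range]; omega
    · intro j; simp only [Finset.mem_filter, Finset.mem_range]; omega
    · intro j; simp only [Finset.mem_filter, Finset.mem_range]; intro h; congr 1; omega

/-- The part of `C_{p+q}(re w)` that is homogeneous of weight `p - q` under rotations of `w`. -/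
def gegenbauerPart (lam : ℝ) (p q : ℕ) (w : ℂ) : ℂ :=
  ∑ i ∈ Finset.range (min p q + 1),
    ((-1) ^ i * poch lam (p + q - i) /
      ((i.factorial : ℝ) * ((p - i).factorial : ℝ) * ((q - i).factorial : ℝ)) : ℝ) *
      (w ^ (p - i) * (starRingEnd ℂ w) ^ (q - i))

/-- Since `2 re w = w + conj w`, the binomial theorem gives monomials in `w` and its conjugate;
these are regrouped by `p = i + j`, which at fixed `k` determines the rotation weight. -/
lemma gegenbauer_eq_sum_part (lam : ℝ) (k : ℕ) (w : ℂ) :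
    (gegenbauer lam k w.re : ℂ) =
      ∑ p ∈ Finset.range (k + 1), gegenbauerPart lam p (k - p) w := by
  have h1 : (gegenbauer lam k w.re : ℂ) =
      ∑ i ∈ Finset.range (k / 2 + 1), ∑ j ∈ Finset.range (k - 2 * i + 1),
      ((-1) ^ i * poch lam (k - i) /
      ((i.factorial : ℝ) * (j.factorial : ℝ) * ((k - 2 * i - j).factorial : ℝ)) : ℝ) *
      (w ^ j * (starRingEnd ℂ w) ^ (k - 2 * i - j)) := by
    rw [gegenbauer, Complex.ofReal_sum]
    refine Finset.sum_congr rfl fun i _ => ?_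
    rw [Complex.ofReal_mul, Complex.ofReal_pow, ← Complex.add_conj, add_pow, Finset.mul_sum]
    refine Finset.sum_congr rfl fun j hj => ?_
    rw [Nat.cast_choose ℂ (Nat.lt_succ_iff.1 (Finset.mem_range.1 hj))]
    have := Nat.factorial_ne_zero (k - 2 * i)
    push_cast
    field_simp
  rw [h1, Finset.sum_sigma']
  simp only [gegenbauerPart]
  rw [Finset.sum_sigma']
  refine Finset.sum_bij' (fun a _ => ⟨a.1 + a.2, a.1⟩) (fun a _ => ⟨a.2, a.1 - a.2⟩) ?_ ?_ ?_ ?_ ?_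
  · rintro ⟨i, j⟩; simp only [Finset.mem_sigma, Finset.mem_range]; omega
  · rintro ⟨i, j⟩; simp only [Finset.mem_sigma, Finset.mem_range]; omega
  · rintro ⟨i, j⟩; simp
  · rintro ⟨i, j⟩; simp only [Finset.mem_sigma, Finset.mem_range]
    intro h; rw [Nat.add_sub_cancel' (by omega)]
  · rintro ⟨i, j⟩; simp only [Finset.mem_sigma, Finset.mem_range]
    intro h
    rw [show i + j + (k - (i + j)) = k by omega, show i + j - i = j by omega,
      show k - (i + j) - i = k - 2 * i - j by omega]

/-- Exchanging `p` and `q` conjugates the part, because its coefficients are real and symmetric. -/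
lemma gegenbauerPart_conj (lam : ℝ) (p q : ℕ) (w : ℂ) :
    (gegenbauerPart lam q p w).re = (gegenbauerPart lam p q w).re := by
  rw [← Complex.conj_re (gegenbauerPart lam p q w), gegenbauerPart, gegenbauerPart, map_sum,
    min_comm]
  congr 1
  refine Finset.sum_congr rfl fun i _ => ?_
  rw [map_mul, map_mul, map_pow, map_pow, Complex.conj_conj, Complex.conj_ofReal, add_comm q p]
  push_cast
  ring

/-- After factoring out `w ^ m`, a polynomial in `|w|²` remains. Read in reverse order, its
coefficients are those of a Jacobi polynomial with `α = lam - 1` and `β = m`. -/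
lemma gegenbauerPart_re (lam : ℝ) (m l : ℕ) (w : ℂ) :
    (gegenbauerPart lam (m + l) l w).re = poch lam (m + l) / (m + l).factorial *
      jacobi (lam - 1) m l (2 * Complex.normSq w - 1) * (w ^ m).re := by
  have h1 : gegenbauerPart lam (m + l) l w = ((poch lam (m + l) / (m + l).factorial *
      jacobi (lam - 1) m l (2 * Complex.normSq w - 1) : ℝ) : ℂ) * w ^ m := by
    rw [jacobi_eq_sum_pow, ← Finset.sum_range_reflect, gegenbauerPart, Finset.mul_sum,
      Complex.ofReal_sum, Finset.sum_mul, Nat.min_eq_right (Nat.le_add_left _ _)]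
    refine Finset.sum_congr rfl fun i hi => ?_
    have hi' : i ≤ l := Nat.lt_succ_iff.1 (Finset.mem_range.1 hi)
    obtain ⟨j, rfl⟩ := Nat.exists_eq_add_of_le hi'
    have e1 : i + j + 1 - 1 - i = j := by omega
    have e2 : i + j - i = j := by omega
    have e3 : i + j - j = i := by omega
    have e4 : m + (i + j) - i = m + j := by omega
    have e5 : m + (i + j) + (i + j) - i = m + (i + j) + j := by omega
    rw [e1, e2, e4, e5, jacobiCoeff, e3, poch_add]
    have e6 : ((i + j : ℕ) + (lam - 1) + m + 1 : ℝ) = lam + (m + (i + j) : ℕ) := by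
      push_cast; ring
    have e7 := poch_natCast_succ (m + j) i
    rw [show m + j + i = m + (i + j) by ring] at e7
    push_cast at e7
    rw [e6, e7]
    have hc : (w : ℂ) ^ (m + j) * (starRingEnd ℂ w) ^ j = (Complex.normSq w ^ j : ℝ) * w ^ m := by
      rw [Complex.ofReal_pow, ← Complex.mul_conj, mul_pow, pow_add]; ring
    rw [hc, ← mul_assoc, ← Complex.ofReal_mul]
    congr 2
    have := Nat.factorial_ne_zero (m + (i + j))
    field_simp
  rw [h1, Complex.re_ofReal_mul]

/-- The multiplicity of the angular frequency `k - 2 l`. -/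
def kappa (l k : ℕ) : ℝ := if 2 * l < k then 2 else 1

lemma kappa_pos (l k : ℕ) : 0 < kappa l k := by rw [kappa]; split_ifs <;> norm_num

lemma gegenbauer_re (lam : ℝ) (k : ℕ) (w : ℂ) :
    gegenbauer lam k w.re = ∑ l ∈ Finset.range (k / 2 + 1),
      kappa l k * (poch lam (k - l) / (k - l).factorial *
        jacobi (lam - 1) (k - 2 * l : ℕ) l (2 * Complex.normSq w - 1) * (w ^ (k - 2 * l)).re) := by
  have h := congrArg Complex.re (gegenbauer_eq_sum_part lam k w)
  rw [Complex.ofReal_re, sum_range_fold, Complex.re_sum] at h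
  rw [h]
  refine Finset.sum_congr rfl fun l hl => ?_
  have hl' : 2 * l ≤ k := by have := Finset.mem_range.1 hl; omega
  have h1 := gegenbauerPart_re lam (k - 2 * l) l w
  rw [show k - 2 * l + l = k - l by omega] at h1
  rw [← h1, kappa, gegenbauerPart_conj lam l (k - l)]
  split_ifs with h2
  · rw [Complex.add_re, Nat.sub_sub_self (by omega), gegenbauerPart_conj lam l (k - l)]; ring
  · rw [add_zero, one_mul]

/-- With `z = x + i y` and `ζ = e^{iξ}`, the ridge variable is the real part of `z * conj ζ`, whose
modulus is that of `z`. The real part of `z ^ m * conj ζ ^ m` splits into the products for `ε = 0`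
and `ε = 1`. -/
lemma gegenbauer_ridge (lam : ℝ) (k : ℕ) (x y ξ : ℝ) :
    gegenbauer lam k (x * Real.cos ξ + y * Real.sin ξ) = ∑ l ∈ Finset.range (k / 2 + 1),
      ∑ ε : Fin 2, kappa l k * (poch lam (k - l) / (k - l).factorial) *
        jacobi (lam - 1) (k - 2 * l : ℕ) l (2 * (x ^ 2 + y ^ 2) - 1) *
        solid (k - 2 * l) ε x y * solid (k - 2 * l) ε (Real.cos ξ) (Real.sin ξ) := by
  have h := gegenbauer_re lam k (⟨x, y⟩ * starRingEnd ℂ ⟨Real.cos ξ, Real.sin ξ⟩)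
  have h1 : (⟨x, y⟩ * starRingEnd ℂ ⟨Real.cos ξ, Real.sin ξ⟩ : ℂ).re =
    x * Real.cos ξ + y * Real.sin ξ := by simp
  have h2 : Complex.normSq (⟨x, y⟩ * starRingEnd ℂ ⟨Real.cos ξ, Real.sin ξ⟩) = x ^ 2 + y ^ 2 := by
    rw [map_mul, Complex.normSq_conj, Complex.normSq_mk, Complex.normSq_mk]
    linear_combination (x * x + y * y) * Real.cos_sq_add_sin_sq ξ
  rw [h1, h2] at h
  rw [h]
  refine Finset.sum_congr rfl fun l _ => ?_
  rw [Fin.sum_univ_two, mul_pow, ← map_pow, Complex.mul_re, Complex.conj_re, Complex.conj_im]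
  simp only [solid, if_true, one_ne_zero, if_false]
  ring

/-! ### Discrete orthogonality on the circle -/

lemma circle_pow (m : ℕ) (ξ : ℝ) :
    (⟨Real.cos ξ, Real.sin ξ⟩ : ℂ) ^ m = ⟨Real.cos (m * ξ), Real.sin (m * ξ)⟩ := by
  have h (t : ℝ) : (⟨Real.cos t, Real.sin t⟩ : ℂ) = Complex.exp (t * Complex.I) := by
    apply Complex.ext
    · simp [Complex.exp_ofReal_mul_I_re]
    · simp [Complex.exp_ofReal_mul_I_im]
  rw [h, h, ← Complex.exp_nat_mul]
  push_cast; ring_nf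

lemma solid_circle_zero (m : ℕ) (ξ : ℝ) :
    solid m 0 (Real.cos ξ) (Real.sin ξ) = Real.cos (m * ξ) := by
  rw [solid, circle_pow, if_pos rfl]

lemma solid_circle_one (m : ℕ) (ξ : ℝ) :
    solid m 1 (Real.cos ξ) (Real.sin ξ) = Real.sin (m * ξ) := by
  rw [solid, circle_pow, if_neg one_ne_zero]

/-- A geometric sum over powers of an `(n + 1)`-th root of unity. The root is not `1` when `0 < |j|
≤ n`, as `n + 1` cannot then divide `j`. -/
lemma sum_exp_angle (n : ℕ) (j : ℤ) (hj : j.natAbs ≤ n) :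
    ∑ ν ∈ Finset.range (n + 1), Complex.exp ((2 * j * angle n ν : ℝ) * Complex.I) =
      if j = 0 then (n + 1 : ℂ) else 0 := by
  split_ifs with h0
  · simp [h0]
  set ζ : ℂ := Complex.exp (2 * Real.pi * Complex.I * j / (n + 1)) with hζ
  have hn : (n + 1 : ℂ) ≠ 0 := by exact_mod_cast n.succ_ne_zero
  have hp : (2 * Real.pi * Complex.I : ℂ) ≠ 0 := by simp [Real.pi_ne_zero]
  have h1 : ∀ ν ∈ Finset.range (n + 1),
      Complex.exp ((2 * j * angle n ν : ℝ) * Complex.I) = ζ ^ ν := by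
    intro ν _
    rw [hζ, ← Complex.exp_nat_mul, angle]
    congr 1; push_cast; field_simp
  rw [Finset.sum_congr rfl h1]
  have h2 : ζ ≠ 1 := by
    rw [hζ, Ne, Complex.exp_eq_one_iff]
    rintro ⟨a, ha⟩
    have h3 : (j : ℂ) = a * (n + 1) := by
      field_simp at ha
      have h4 : (2 * Real.pi * Complex.I : ℂ) * (j - a * (n + 1)) = 0 := by
        linear_combination (2 * Real.pi * Complex.I) * ha
      simpa [hp, sub_eq_zero, Real.pi_ne_zero] using h4
    have h4 : j = a * (n + 1 : ℕ) := by exact_mod_cast h3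
    have h5 : (n + 1) ∣ j.natAbs := by
      rw [h4, Int.natAbs_mul, Int.natAbs_natCast]; exact dvd_mul_left _ _
    have := Nat.le_of_dvd (Int.natAbs_pos.2 h0) h5
    omega
  have h3 : ζ ^ (n + 1) = 1 := by
    rw [hζ, ← Complex.exp_nat_mul, Complex.exp_eq_one_iff]
    exact ⟨j, by push_cast; field_simp⟩
  rw [geom_sum_eq h2, h3, sub_self, zero_div]

lemma sum_cos_angle (n : ℕ) (j : ℤ) (hj : j.natAbs ≤ n) :
    ∑ ν ∈ Finset.range (n + 1), Real.cos (2 * j * angle n ν) =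
      if j = 0 then (n + 1 : ℝ) else 0 := by
  have h := congrArg Complex.re (sum_exp_angle n j hj)
  rw [Complex.re_sum] at h
  simp only [Complex.exp_ofReal_mul_I_re] at h
  rw [h]; split_ifs <;> simp

lemma sum_sin_angle (n : ℕ) (j : ℤ) (hj : j.natAbs ≤ n) :
    ∑ ν ∈ Finset.range (n + 1), Real.sin (2 * j * angle n ν) = 0 := by
  have h := congrArg Complex.im (sum_exp_angle n j hj)
  rw [Complex.im_sum] at h
  simp only [Complex.exp_ofReal_mul_I_im] at h
  rw [h]; split_ifs <;> simp

/-- The mean value of `cos ^ 2 (m φ)` for `ε = 0`, and of `sin ^ 2 (m φ)` for `ε = 1`. -/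
def solidMean (m : ℕ) (ε : Fin 2) : ℝ := if m = 0 then if ε = 0 then 1 else 0 else 1 / 2

lemma sum_solid_mul_solid (n m m' : ℕ) (ε ε' : Fin 2) (hm : m ≤ n) (hm' : m' ≤ n)
    (hpar : (m + m') % 2 = 0) :
    ∑ ν ∈ Finset.range (n + 1),
      solid m ε (Real.cos (angle n ν)) (Real.sin (angle n ν)) *
        solid m' ε' (Real.cos (angle n ν)) (Real.sin (angle n ν)) =
      if m = m' ∧ ε = ε' then (n + 1 : ℝ) * solidMean m ε else 0 := by
  rw [solidMean]
  -- Equal parity makes the half sum `a` and half difference `b` integers. This is essential because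
  -- the angles fill only a half turn, so only even frequencies `2 a`, `2 b` sum to zero.
  obtain ⟨a, ha⟩ : ∃ a : ℤ, (m : ℤ) + m' = 2 * a := ⟨((m + m' : ℕ) : ℤ) / 2, by omega⟩
  obtain ⟨b, hb⟩ : ∃ b : ℤ, (m : ℤ) - m' = 2 * b := ⟨a - m', by omega⟩
  have ha' : (m : ℝ) + m' = 2 * a := by exact_mod_cast ha
  have hb' : (m : ℝ) - m' = 2 * b := by exact_mod_cast hb
  have ca := sum_cos_angle n a (by omega)
  have cb := sum_cos_angle n b (by omega)
  have sa := sum_sin_angle n a (by omega)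
  have sb := sum_sin_angle n b (by omega)
  have plus (t : ℝ) : 2 * a * t = m * t + m' * t := by rw [← ha']; ring
  have minus (t : ℝ) : 2 * b * t = m * t - m' * t := by rw [← hb']; ring
  simp only [plus, minus, Real.cos_add, Real.cos_sub, Real.sin_add, Real.sin_sub,
    Finset.sum_add_distrib, Finset.sum_sub_distrib] at ca cb sa sb
  have hb0 : m = m' ↔ b = 0 := by omega
  have hm0 : m = 0 ↔ a + b = 0 := by omega
  have hab : a = 0 → b = 0 := by omega
  simp only [hb0, hm0]
  by_cases h : b = 0 <;> by_cases h0 : a = 0 <;>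
    simp only [h, h0, if_true, if_false, add_zero, true_and, false_and] at ca cb hab ⊢ <;>
    fin_cases ε <;> fin_cases ε' <;>
    simp only [Fin.zero_eta, Fin.mk_one, solid_circle_zero, solid_circle_one, one_ne_zero,
      zero_ne_one, if_false, if_true, forall_const] at hab ⊢ <;> linarith

/-! ### Moments of the Jacobi weight on `[0, 1]` -/

lemma integral_rpow_mul_pow {α : ℝ} (hα : -1 < α) (n : ℕ) :
    ∫ r in (0 : ℝ)..1, (1 - r) ^ α * r ^ n = n.factorial / poch (α + 1) (n + 1) := by
  have h1 := Complex.betaIntegral_eval_nat_add_one_right (u := (α : ℂ) + 1)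
    (by simp; linarith) n
  have h2 : Complex.betaIntegral ((α : ℂ) + 1) (n + 1) =
      ((∫ r in (0 : ℝ)..1, r ^ α * (1 - r) ^ n : ℝ) : ℂ) := by
    rw [Complex.betaIntegral, ← intervalIntegral.integral_ofReal]
    refine intervalIntegral.integral_congr fun x hx => ?_
    rw [Set.uIcc_of_le zero_le_one] at hx
    simp only [add_sub_cancel_right, Complex.cpow_natCast]
    rw [Complex.ofReal_mul, Complex.ofReal_cpow hx.1]
    push_cast; rfl
  have h3 := intervalIntegral.integral_comp_sub_left (a := 0) (b := 1)
    (fun r : ℝ => r ^ α * (1 - r) ^ n) 1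
  simp only [sub_sub_cancel, sub_self, sub_zero] at h3
  rw [h3]
  rw [h2] at h1
  rw [poch_eq_prod]
  exact_mod_cast h1

/-- The integral of a non-integrable function is zero by convention, whereas the Beta integral gives
a positive value. -/
lemma intervalIntegrable_rpow {α : ℝ} (hα : -1 < α) :
    IntervalIntegrable (fun r : ℝ => (1 - r) ^ α) volume 0 1 := by
  by_contra h
  have h1 := integral_rpow_mul_pow hα 0
  simp only [pow_zero, mul_one] at h1
  rw [intervalIntegral.integral_undef h] at h1
  have := poch_pos (c := α + 1) (by linarith) 1
  simp at h1
  linarith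

lemma intervalIntegrable_continuous_mul_rpow {α : ℝ} (hα : -1 < α) {F : ℝ → ℝ}
    (hF : Continuous F) : IntervalIntegrable (fun r : ℝ => F r * (1 - r) ^ α) volume 0 1 :=
  (intervalIntegrable_rpow hα).continuousOn_mul hF.continuousOn

lemma integral_one_sub_pow_mul {α : ℝ} (hα : -1 < α) (i n : ℕ) :
    ∫ r in (0 : ℝ)..1, (1 - r) ^ i * r ^ n * (1 - r) ^ α =
      n.factorial / poch (α + 1 + i) (n + 1) := by
  rw [show α + 1 + i = (α + i) + 1 by ring, ← integral_rpow_mul_pow (by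
    have : (0 : ℝ) ≤ i := i.cast_nonneg
    linarith)]
  refine intervalIntegral.integral_congr_ae ?_
  -- At `r = 1` the exponent law for real powers may fail, the base being zero.
  filter_upwards [Measure.ae_ne volume (1 : ℝ)] with r hr hr'
  rw [Set.uIoc_of_le zero_le_one] at hr'
  have h : 0 < 1 - r := sub_pos.2 (lt_of_le_of_ne hr'.2 hr)
  rw [Real.rpow_add_natCast h.ne']
  ring

lemma continuous_jacobi (α β : ℝ) (n : ℕ) : Continuous (jacobi α β n) := by
  unfold jacobi; fun_prop

/-- In powers of `1 - r` every term is a Beta integral, and Chu-Vandermonde sums them. The factor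
`poch (b + 1 - n) n` carries the orthogonality: it contains a zero exactly when `b < n`. -/
lemma jacobi_moment {α : ℝ} (hα : -1 < α) (m n b : ℕ) :
    ∫ r in (0 : ℝ)..1, jacobi α m n (2 * r - 1) * r ^ (m + b) * (1 - r) ^ α =
      (m + b).factorial * poch (α + 1) n /
        (poch (α + 1) (m + b + 1) * poch (α + 1 + (m + b + 1 : ℕ)) n) *
        (poch (b + 1 - n) n / n.factorial) := by
  have hα' : 0 < α + 1 := by linarith
  have h1 : ∀ r : ℝ, jacobi α m n (2 * r - 1) * r ^ (m + b) * (1 - r) ^ α =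
      ∑ i ∈ Finset.range (n + 1),
        ((-1) ^ i * poch (n + α + m + 1) i * poch (α + i + 1) (n - i) /
        ((i.factorial : ℝ) * ((n - i).factorial : ℝ))) *
        ((1 - r) ^ i * r ^ (m + b) * (1 - r) ^ α) := by
    intro r
    rw [jacobi_eq_sum_one_sub, Finset.sum_mul, Finset.sum_mul]
    refine Finset.sum_congr rfl fun i _ => by ring
  simp only [h1]
  rw [intervalIntegral.integral_finsetSum]
  · have h2 := sum_range_choose_poch (n + α + m + 1) (α + 1 + (m + b + 1 : ℕ)) n
    rw [show α + 1 + ((m + b + 1 : ℕ) : ℝ) - (n + α + m + 1) = b + 1 - n by push_cast; ring] at h2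
    rw [← h2, Finset.mul_sum]
    refine Finset.sum_congr rfl fun i hi => ?_
    have hi' : i + (n - i) = n := by have := Finset.mem_range.1 hi; omega
    rw [intervalIntegral.integral_const_mul, integral_one_sub_pow_mul hα]
    have e1 := poch_add (α + 1) i (n - i)
    have e2 := poch_add (α + 1) i (m + b + 1)
    have e3 := poch_add (α + 1) (m + b + 1) i
    have e4 := poch_add (α + 1 + (m + b + 1 : ℕ)) i (n - i)
    rw [hi'] at e1 e4
    rw [add_comm i, e3] at e2
    have p1 := poch_pos hα' i
    have p2 := poch_pos hα' (m + b + 1)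
    have p3 := poch_pos (c := α + 1 + (m + b + 1 : ℕ)) (by positivity) n
    have p4 := poch_pos (c := α + 1 + i) (by positivity) (m + b + 1)
    have p5 : poch (α + 1 + (m + b + 1 : ℕ)) i ≠ 0 := (poch_pos (by positivity) i).ne'
    have p6 := poch_pos (c := α + 1 + i) (by positivity) (n - i)
    have p7 : poch (α + 1 + (m + b + 1 : ℕ) + i) (n - i) ≠ 0 := (poch_pos (by positivity) _).ne'
    have e5 : poch (α + 1 + i) (m + b + 1) =
      poch (α + 1) (m + b + 1) * poch (α + 1 + (m + b + 1 : ℕ)) i / poch (α + 1) i := by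
      rw [e2]; field_simp
    rw [show α + i + 1 = α + 1 + i by ring, e5, e1, e4]
    field_simp
  · intro i _
    exact (intervalIntegrable_continuous_mul_rpow hα (F := fun r => (1 - r) ^ i * r ^ (m + b))
      (by fun_prop)).const_mul _

lemma jacobi_moment_eq_zero {α : ℝ} (hα : -1 < α) (m : ℕ) {n b : ℕ} (hb : b < n) :
    ∫ r in (0 : ℝ)..1, jacobi α m n (2 * r - 1) * r ^ (m + b) * (1 - r) ^ α = 0 := by
  have h : poch (b + 1 - n : ℝ) n = 0 := by
    refine poch_neg_eq_zero (b := n - 1 - b) (by omega) ?_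
    rw [Nat.cast_sub (by omega), Nat.cast_sub (by omega)]
    push_cast; ring
  rw [jacobi_moment hα, h, zero_div, mul_zero]

lemma jacobi_moment_pos {α : ℝ} (hα : -1 < α) (m n : ℕ) :
    0 < ∫ r in (0 : ℝ)..1, jacobi α m n (2 * r - 1) * r ^ (m + n) * (1 - r) ^ α := by
  have hα' : 0 < α + 1 := by linarith
  rw [jacobi_moment hα, add_sub_cancel_left, poch_one]
  have p1 := poch_pos hα' n
  have p2 := poch_pos hα' (m + n + 1)
  have p3 := poch_pos (c := α + 1 + (m + n + 1 : ℕ)) (by positivity) n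
  positivity

/-- The square of the norm of the Jacobi polynomial, in the variable `r = (1 + t) / 2`. -/
def jacobiSq (α : ℝ) (m n : ℕ) : ℝ :=
  ∫ r in (0 : ℝ)..1, jacobi α m n (2 * r - 1) ^ 2 * r ^ m * (1 - r) ^ α

/-- Expanding one of the two factors in powers of `r`, orthogonality leaves only the top power,
whose coefficient and moment are both positive. -/
lemma jacobiSq_pos {α : ℝ} (hα : -1 < α) (m n : ℕ) : 0 < jacobiSq α m n := by
  have h1 : ∀ r : ℝ, jacobi α m n (2 * r - 1) ^ 2 * r ^ m * (1 - r) ^ α =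
      ∑ j ∈ Finset.range (n + 1), jacobiCoeff α m n j *
        (jacobi α m n (2 * r - 1) * r ^ (m + j) * (1 - r) ^ α) := by
    intro r
    rw [sq]
    nth_rewrite 2 [jacobi_eq_sum_pow]
    rw [Finset.mul_sum, Finset.sum_mul, Finset.sum_mul]
    refine Finset.sum_congr rfl fun i _ => by ring
  have hc := continuous_jacobi α m n
  rw [jacobiSq]
  simp only [h1]
  rw [intervalIntegral.integral_finsetSum, Finset.sum_range_succ, Finset.sum_eq_zero, zero_add,
    intervalIntegral.integral_const_mul]
  · refine mul_pos ?_ (jacobi_moment_pos hα m n)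
    rw [jacobiCoeff, Nat.sub_self, pow_zero, poch_zero]
    have h : 0 < poch (n + α + m + 1) n := by
      have hm : (0 : ℝ) ≤ m := m.cast_nonneg
      rcases n with _ | n
      · simp
      · exact poch_pos (by push_cast; have : (0 : ℝ) ≤ n := n.cast_nonneg; linarith) _
    positivity
  · intro j hj
    rw [intervalIntegral.integral_const_mul, jacobi_moment_eq_zero hα m (Finset.mem_range.1 hj),
      mul_zero]
  · intro j _
    exact (intervalIntegrable_continuous_mul_rpow hα
      (F := fun r => jacobi α m n (2 * r - 1) * r ^ (m + j)) (by fun_prop)).const_mul _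

lemma integral_jacobiWeight (α : ℝ) (m : ℕ) (F : ℝ → ℝ) :
    ∫ u in (-1 : ℝ)..1, F u * jacobiWeight α m u =
      2 * (2 : ℝ) ^ α * 2 ^ m * ∫ r in (0 : ℝ)..1, F (2 * r - 1) * r ^ m * (1 - r) ^ α := by
  have h := intervalIntegral.integral_comp_mul_sub (a := 0) (b := 1)
    (fun u => F u * jacobiWeight α m u) (c := 2) two_ne_zero 1
  rw [show (2 : ℝ) * 0 - 1 = -1 by norm_num, show (2 : ℝ) * 1 - 1 = 1 by norm_num, smul_eq_mul] at h
  have h2 : ∫ r in (0 : ℝ)..1, F (2 * r - 1) * jacobiWeight α m (2 * r - 1) =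
      ∫ r in (0 : ℝ)..1, (2 : ℝ) ^ α * 2 ^ m * (F (2 * r - 1) * r ^ m * (1 - r) ^ α) := by
    refine intervalIntegral.integral_congr fun r hr => ?_
    rw [Set.uIcc_of_le zero_le_one] at hr
    simp only [jacobiWeight]
    rw [show 1 - (2 * r - 1) = 2 * (1 - r) by ring, show 1 + (2 * r - 1) = 2 * r by ring,
      Real.mul_rpow two_pos.le (by linarith [hr.2]), Real.rpow_natCast, mul_pow]
    ring
  rw [h2, intervalIntegral.integral_const_mul] at h
  linear_combination (-2) * h

/-- The squared norm of the Jacobi polynomial for the weight normalized to have integral one. -/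
def jacobiRatio (α : ℝ) (m n : ℕ) : ℝ :=
  jacobiSq α m n * poch (α + 1) (m + 1) / m.factorial

lemma jacobiRatio_pos {α : ℝ} (hα : -1 < α) (m n : ℕ) : 0 < jacobiRatio α m n := by
  have := jacobiSq_pos hα m n
  have := poch_pos (c := α + 1) (by linarith) (m + 1)
  rw [jacobiRatio]; positivity

lemma jacobiOrthonormal_eq {α : ℝ} (hα : -1 < α) (m n : ℕ) (t : ℝ) :
    jacobiOrthonormal α m n t = jacobi α m n t / Real.sqrt (jacobiRatio α m n) := by
  have h1 := integral_jacobiWeight α m (fun u => jacobi α m n u ^ 2)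
  have h2 := integral_jacobiWeight α m (fun _ => 1)
  have h3 := integral_rpow_mul_pow hα m
  simp only [one_mul] at h2
  simp only [mul_comm _ ((1 - _ : ℝ) ^ α), h3] at h2
  rw [jacobiOrthonormal, h1, h2, jacobiRatio, ← jacobiSq]
  have := poch_pos (c := α + 1) (by linarith) (m + 1)
  congr 2
  field_simp

/-! ### Integration over the disk in polar coordinates -/

lemma measurableSet_disk : MeasurableSet disk :=
  measurableSet_le (by fun_prop) (by fun_prop)

lemma isCompact_disk : IsCompact disk := by
  refine Metric.isCompact_of_isClosed_isBounded
    (isClosed_le (by fun_prop) (by fun_prop)) ?_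
  refine (Metric.isBounded_Icc (-1 : ℝ) 1).prod (Metric.isBounded_Icc (-1 : ℝ) 1) |>.subset ?_
  rintro ⟨x, y⟩ hq
  have hq' : x ^ 2 + y ^ 2 ≤ 1 := hq
  simp only [Set.mem_prod, Set.mem_Icc]
  refine ⟨abs_le.1 (abs_le_one_iff_mul_self_le_one.2 ?_),
    abs_le.1 (abs_le_one_iff_mul_self_le_one.2 ?_)⟩ <;> nlinarith [sq_nonneg x, sq_nonneg y]

/-- The point `x + i y` of the complex plane. -/
def toComplex (q : ℝ × ℝ) : ℂ := ⟨q.1, q.2⟩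

@[fun_prop] lemma continuous_toComplex : Continuous toComplex := by
  have : toComplex = fun q : ℝ × ℝ => (q.1 : ℂ) + q.2 * Complex.I :=
    funext fun q => Complex.mk_eq_add_mul_I _ _
  rw [this]; fun_prop

lemma integral_circle_exp (p q : ℕ) :
    ∫ θ in Set.Ioo (-Real.pi) Real.pi,
      Complex.exp (θ * Complex.I) ^ p * starRingEnd ℂ (Complex.exp (θ * Complex.I)) ^ q =
      if p = q then ((2 * Real.pi : ℝ) : ℂ) else 0 := by
  rw [← integral_Ioc_eq_integral_Ioo, ← intervalIntegral.integral_of_le (by linarith [Real.pi_pos])]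
  have h : ∀ θ : ℝ, Complex.exp (θ * Complex.I) ^ p *
      starRingEnd ℂ (Complex.exp (θ * Complex.I)) ^ q =
      Complex.exp (((p - q : ℂ) * Complex.I) * θ) := by
    intro θ
    rw [← Complex.exp_conj, ← Complex.exp_nat_mul, ← Complex.exp_nat_mul, ← Complex.exp_add,
      map_mul, Complex.conj_I, Complex.conj_ofReal]
    congr 1; ring
  simp only [h]
  split_ifs with hpq
  · subst hpq; simp; ring
  · have hpq' : (p - q : ℂ) ≠ 0 := sub_ne_zero.2 (by exact_mod_cast hpq)
    rw [integral_exp_mul_complex (mul_ne_zero hpq' Complex.I_ne_zero), div_eq_zero_iff]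
    left
    rw [sub_eq_zero, Complex.exp_eq_exp_iff_exists_int]
    exact ⟨p - q, by push_cast; ring⟩

/-- In polar coordinates the angular integral forces `p = q`, and substituting the squared radius
removes the Jacobian. No integrability of `g` is assumed: the product and substitution formulas hold
unconditionally, so the lemma can itself be used to prove integrability. -/
lemma setIntegral_disk_radial (g : ℝ → ℝ) (p q : ℕ) :
    ∫ z in disk, (g (z.1 ^ 2 + z.2 ^ 2) : ℂ) *
      (toComplex z ^ p * starRingEnd ℂ (toComplex z) ^ q) =
      if p = q then ((Real.pi * ∫ r in (0 : ℝ)..1, g r * r ^ p : ℝ) : ℂ) else 0 := by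
  rw [← integral_indicator measurableSet_disk, ← integral_comp_polarCoord_symm]
  have h1 : ∀ z ∈ polarCoord.target, z.1 • disk.indicator (fun z => (g (z.1 ^ 2 + z.2 ^ 2) : ℂ) *
      (toComplex z ^ p * starRingEnd ℂ (toComplex z) ^ q)) (polarCoord.symm z) =
      ((z.1 * ((Set.Iic 1).indicator g (z.1 ^ 2) * z.1 ^ (p + q)) : ℝ) : ℂ) *
      (Complex.exp (z.2 * Complex.I) ^ p * starRingEnd ℂ (Complex.exp (z.2 * Complex.I)) ^ q) := by
    rintro ⟨r, θ⟩ _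
    have e1 : (r * Real.cos θ) ^ 2 + (r * Real.sin θ) ^ 2 = r ^ 2 := by
      linear_combination r ^ 2 * Real.cos_sq_add_sin_sq θ
    have e2 : toComplex (r * Real.cos θ, r * Real.sin θ) = r * Complex.exp (θ * Complex.I) := by
      apply Complex.ext
      · simp [toComplex, Complex.exp_ofReal_mul_I_re]
      · simp [toComplex, Complex.exp_ofReal_mul_I_im]
    have e3 : ((r * Real.cos θ, r * Real.sin θ) ∈ disk) ↔ r ^ 2 ∈ Set.Iic 1 := by
      simp only [disk, Set.mem_ofPred_eq, e1, Set.mem_Iic]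
    rw [polarCoord_symm_apply]
    by_cases h : r ^ 2 ∈ Set.Iic 1
    · rw [Set.indicator_of_mem (e3.2 h), Set.indicator_of_mem h]
      simp only [e1, e2, Complex.real_smul, map_mul, Complex.conj_ofReal]
      push_cast; ring
    · rw [Set.indicator_of_notMem (mt e3.1 h), Set.indicator_of_notMem h]
      simp
  rw [setIntegral_congr_fun polarCoord.open_target.measurableSet h1, polarCoord_target,
    Measure.volume_eq_prod,
    setIntegral_prod_mul (fun r : ℝ => ((r * ((Set.Iic 1).indicator g (r ^ 2) * r ^ (p + q)) : ℝ) : ℂ))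
      (fun θ : ℝ => Complex.exp (θ * Complex.I) ^ p *
        starRingEnd ℂ (Complex.exp (θ * Complex.I)) ^ q), integral_circle_exp]
  split_ifs with hpq
  · subst hpq
    rw [integral_complex_ofReal, ← Complex.ofReal_mul]
    congr 1
    have h2 := integral_comp_rpow_Ioi_of_pos (g := fun r => (Set.Iic 1).indicator g r * r ^ p)
      (p := 2) two_pos
    have h3 : ∫ r in Set.Ioi (0 : ℝ), (2 * r ^ ((2 : ℝ) - 1)) • ((Set.Iic 1).indicator g (r ^ (2 : ℝ)) *
        (r ^ (2 : ℝ)) ^ p) =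
        2 * ∫ r in Set.Ioi (0 : ℝ), r * ((Set.Iic 1).indicator g (r ^ 2) * r ^ (p + p)) := by
      rw [← integral_const_mul]
      refine setIntegral_congr_fun measurableSet_Ioi fun r _ => ?_
      have : (2 : ℝ) - 1 = 1 := by norm_num
      simp only [this, Real.rpow_one, Real.rpow_two, smul_eq_mul]
      ring
    have h4 : ∫ r in Set.Ioi (0 : ℝ), (Set.Iic 1).indicator g r * r ^ p =
        ∫ r in (0 : ℝ)..1, g r * r ^ p := by
      rw [intervalIntegral.integral_of_le zero_le_one, ← Set.Ioi_inter_Iic,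
        ← setIntegral_indicator measurableSet_Iic]
      congr 1; ext r
      simp only [Set.indicator_apply]; split_ifs <;> simp
    rw [h3, h4] at h2
    linear_combination Real.pi * h2
  · rw [mul_zero]

/-- As for the interval, the integral computed by `setIntegral_disk_radial` is positive, which
excludes the default value zero. -/
lemma integrableOn_diskWeight {μ : ℝ} (hμ : 0 ≤ μ) :
    IntegrableOn (fun q : ℝ × ℝ => diskWeight μ q.1 q.2) disk := by
  by_contra h
  have h1 := setIntegral_disk_radial (fun r => (1 - r) ^ (μ - 1 / 2)) 0 0
  have h2 := integral_rpow_mul_pow (α := μ - 1 / 2) (by linarith) 0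
  have h3 : ∀ q : ℝ × ℝ, (1 - (q.1 ^ 2 + q.2 ^ 2)) ^ (μ - 1 / 2) = diskWeight μ q.1 q.2 := by
    intro q; rw [diskWeight, sub_sub]
  simp only [pow_zero, mul_one] at h2
  simp only [h3, pow_zero, mul_one, if_true] at h1
  rw [h2, integral_complex_ofReal, integral_undef h, Complex.ofReal_inj] at h1
  have h4 : 0 < poch (μ - 1 / 2 + 1) (0 + 1) := poch_pos (by linarith) _
  have h5 : 0 < Real.pi * ((Nat.factorial 0) / poch (μ - 1 / 2 + 1) (0 + 1)) := by
    have := Real.pi_pos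
    positivity
  exact h5.ne (by exact_mod_cast h1)

lemma integrableOn_mul_disk {g : ℝ × ℝ → ℝ} (hg : IntegrableOn g disk) {F : ℝ × ℝ → ℂ}
    (hF : Continuous F) : IntegrableOn (fun q => (g q : ℂ) * F q) disk :=
  IntegrableOn.mul_continuousOn (Integrable.ofReal hg) hF.continuousOn isCompact_disk

/-! ### Polynomials in `z` and its conjugate -/

/-- The span of the functions `z ^ a * conj z ^ b` with `a + b ≤ d`. -/
def bidegreeSpan (d : ℕ) : Submodule ℂ (ℝ × ℝ → ℂ) :=
  Submodule.span ℂ {F | ∃ a b, a + b ≤ d ∧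
    F = fun q => toComplex q ^ a * starRingEnd ℂ (toComplex q) ^ b}

lemma bidegreeSpan_mono {d e : ℕ} (h : d ≤ e) : bidegreeSpan d ≤ bidegreeSpan e :=
  Submodule.span_mono fun _ ⟨a, b, hab, hF⟩ => ⟨a, b, hab.trans h, hF⟩

lemma mul_mem_bidegreeSpan {d e : ℕ} {F G : ℝ × ℝ → ℂ} (hF : F ∈ bidegreeSpan d)
    (hG : G ∈ bidegreeSpan e) : F * G ∈ bidegreeSpan (d + e) := by
  have h := Submodule.mul_mem_mul hF hG
  rw [bidegreeSpan, bidegreeSpan, Submodule.span_mul_span] at h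
  refine Submodule.span_mono ?_ h
  rintro _ ⟨_, ⟨a, b, hab, rfl⟩, _, ⟨a', b', hab', rfl⟩, rfl⟩
  refine ⟨a + a', b + b', by omega, ?_⟩
  ext q
  simp only [Pi.mul_apply, pow_add]
  ring

lemma one_mem_bidegreeSpan : (1 : ℝ × ℝ → ℂ) ∈ bidegreeSpan 0 :=
  Submodule.subset_span ⟨0, 0, le_rfl, by ext; simp⟩

lemma pow_mem_bidegreeSpan {F : ℝ × ℝ → ℂ} (hF : F ∈ bidegreeSpan 1) (n : ℕ) :
    F ^ n ∈ bidegreeSpan n := by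
  induction n with
  | zero => simpa using one_mem_bidegreeSpan
  | succ n ih => rw [pow_succ]; exact mul_mem_bidegreeSpan ih hF

lemma fst_mem_bidegreeSpan : (fun q : ℝ × ℝ => (q.1 : ℂ)) ∈ bidegreeSpan 1 := by
  have h : (fun q : ℝ × ℝ => (q.1 : ℂ)) =
      (1 / 2 : ℂ) • (fun q => toComplex q ^ 1 * starRingEnd ℂ (toComplex q) ^ 0) +
      (1 / 2 : ℂ) • (fun q => toComplex q ^ 0 * starRingEnd ℂ (toComplex q) ^ 1) := by
    ext q
    have := Complex.add_conj (toComplex q)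
    simp only [Pi.add_apply, Pi.smul_apply, smul_eq_mul, pow_one, pow_zero, mul_one, one_mul]
    rw [← mul_add, this]; simp [toComplex]
  rw [h]
  exact add_mem (Submodule.smul_mem _ _ (Submodule.subset_span ⟨1, 0, le_rfl, rfl⟩))
    (Submodule.smul_mem _ _ (Submodule.subset_span ⟨0, 1, le_rfl, rfl⟩))

lemma snd_mem_bidegreeSpan : (fun q : ℝ × ℝ => (q.2 : ℂ)) ∈ bidegreeSpan 1 := by
  have h : (fun q : ℝ × ℝ => (q.2 : ℂ)) =
      (-Complex.I / 2 : ℂ) • (fun q => toComplex q ^ 1 * starRingEnd ℂ (toComplex q) ^ 0) -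
      (-Complex.I / 2 : ℂ) • (fun q => toComplex q ^ 0 * starRingEnd ℂ (toComplex q) ^ 1) := by
    ext q
    have := Complex.sub_conj (toComplex q)
    simp only [Pi.sub_apply, Pi.smul_apply, smul_eq_mul, pow_one, pow_zero, mul_one, one_mul]
    rw [← mul_sub, this]
    simp only [toComplex]; push_cast
    linear_combination (q.2 : ℂ) * Complex.I_mul_I
  rw [h]
  exact sub_mem (Submodule.smul_mem _ _ (Submodule.subset_span ⟨1, 0, le_rfl, rfl⟩))
    (Submodule.smul_mem _ _ (Submodule.subset_span ⟨0, 1, le_rfl, rfl⟩))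

/-- Lets orthogonality to all polynomials of bounded degree be tested on monomials in `z` and `conj
z`, for which disk integrals are explicit. -/
lemma eval_mem_bidegreeSpan {d : ℕ} {Q : MvPolynomial (Fin 2) ℝ} (hQ : Q.totalDegree ≤ d) :
    (fun q : ℝ × ℝ => ((MvPolynomial.eval ![q.1, q.2] Q : ℝ) : ℂ)) ∈ bidegreeSpan d := by
  have h : (fun q : ℝ × ℝ => ((MvPolynomial.eval ![q.1, q.2] Q : ℝ) : ℂ)) =
      ∑ s ∈ Q.support, ((MvPolynomial.coeff s Q : ℝ) : ℂ) • ((fun q : ℝ × ℝ => (q.1 : ℂ)) ^ s 0 *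
        (fun q : ℝ × ℝ => (q.2 : ℂ)) ^ s 1) := by
    ext q
    rw [MvPolynomial.eval_eq']
    simp [Fin.prod_univ_two]
  rw [h]
  refine sum_mem fun s hs => Submodule.smul_mem _ _ ?_
  refine bidegreeSpan_mono ?_ (mul_mem_bidegreeSpan (pow_mem_bidegreeSpan fst_mem_bidegreeSpan _)
    (pow_mem_bidegreeSpan snd_mem_bidegreeSpan _))
  have h1 := MvPolynomial.le_totalDegree hs
  rw [Finsupp.sum_fintype _ _ (fun _ => rfl), Fin.sum_univ_two] at h1
  exact h1.trans hQ

lemma continuous_eval_pair {X : Type*} [TopologicalSpace X] {u v : X → ℝ} (hu : Continuous u)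
    (hv : Continuous v) (Q : MvPolynomial (Fin 2) ℝ) :
    Continuous fun q => MvPolynomial.eval ![u q, v q] Q := by
  refine (MvPolynomial.continuous_eval Q).comp ?_
  refine continuous_pi fun i => ?_
  fin_cases i
  exacts [hu, hv]

lemma continuous_eval (Q : MvPolynomial (Fin 2) ℝ) :
    Continuous fun q : ℝ × ℝ => MvPolynomial.eval ![q.1, q.2] Q :=
  continuous_eval_pair continuous_fst continuous_snd Q

/-! ### Solid harmonics and radial weights -/

lemma continuous_solid (m : ℕ) (ε : Fin 2) :
    Continuous fun q : ℝ × ℝ => solid m ε q.1 q.2 := by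
  have h : (fun q : ℝ × ℝ => solid m ε q.1 q.2) =
      fun q => if ε = 0 then (toComplex q ^ m).re else (toComplex q ^ m).im := rfl
  rw [h]
  split_ifs
  · exact Complex.continuous_re.comp (by fun_prop)
  · exact Complex.continuous_im.comp (by fun_prop)

lemma setIntegral_disk_solid {g : ℝ → ℝ}
    (hg : IntegrableOn (fun q : ℝ × ℝ => g (q.1 ^ 2 + q.2 ^ 2)) disk)
    (m : ℕ) (ε : Fin 2) {F : ℝ × ℝ → ℝ} (hF : Continuous F) :
    ∫ q in disk, g (q.1 ^ 2 + q.2 ^ 2) * solid m ε q.1 q.2 * F q =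
      if ε = 0 then (∫ q in disk, (g (q.1 ^ 2 + q.2 ^ 2) : ℂ) * (toComplex q ^ m * F q)).re
      else (∫ q in disk, (g (q.1 ^ 2 + q.2 ^ 2) : ℂ) * (toComplex q ^ m * F q)).im := by
  have hi : IntegrableOn (fun q : ℝ × ℝ =>
      (g (q.1 ^ 2 + q.2 ^ 2) : ℂ) * (toComplex q ^ m * F q)) disk :=
    integrableOn_mul_disk hg (F := fun q => toComplex q ^ m * F q) (by fun_prop)
  split_ifs with hε
  · have h := Complex.reCLM.integral_comp_comm hi
    simp only [Complex.reCLM_apply] at h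
    rw [← h]
    congr 1; ext q
    rw [Complex.re_ofReal_mul, Complex.re_mul_ofReal, solid, if_pos hε, toComplex]; ring
  · have h := Complex.imCLM.integral_comp_comm hi
    simp only [Complex.imCLM_apply] at h
    rw [← h]
    congr 1; ext q
    rw [Complex.im_ofReal_mul, Complex.im_mul_ofReal, solid, if_neg hε, toComplex]; ring

/-- Against `z ^ a * conj z ^ b` only `b = m + a` contributes, so `a + b ≤ d` becomes the condition
in `h0`. Continuity is carried through the span induction since additivity of the integral needs
integrability. -/
lemma setIntegral_disk_bidegree_eq_zero {g : ℝ → ℝ}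
    (hg : IntegrableOn (fun q : ℝ × ℝ => g (q.1 ^ 2 + q.2 ^ 2)) disk) {m d : ℕ}
    (h0 : ∀ a, 2 * a + m ≤ d → ∫ r in (0 : ℝ)..1, g r * r ^ (m + a) = 0)
    {F : ℝ × ℝ → ℂ} (hF : F ∈ bidegreeSpan d) :
    Continuous F ∧
      ∫ q in disk, (g (q.1 ^ 2 + q.2 ^ 2) : ℂ) * (toComplex q ^ m * F q) = 0 := by
  have hi (F : ℝ × ℝ → ℂ) (hF : Continuous F) : IntegrableOn (fun q : ℝ × ℝ =>
      (g (q.1 ^ 2 + q.2 ^ 2) : ℂ) * (toComplex q ^ m * F q)) disk :=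
    integrableOn_mul_disk hg (F := fun q => toComplex q ^ m * F q) (by fun_prop)
  refine Submodule.span_induction (p := fun F _ => Continuous F ∧
      ∫ q in disk, (g (q.1 ^ 2 + q.2 ^ 2) : ℂ) * (toComplex q ^ m * F q) = 0) ?_ ?_ ?_ ?_ hF
  · rintro _ ⟨a, b, hab, rfl⟩
    refine ⟨?_, ?_⟩
    · have : Continuous fun q => starRingEnd ℂ (toComplex q) :=
        Complex.continuous_conj.comp continuous_toComplex
      fun_prop
    · simp only [← mul_assoc (toComplex _ ^ m), ← pow_add]
      rw [setIntegral_disk_radial]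
      split_ifs with h
      · rw [h0 a (by omega)]; simp
      · rfl
  · exact ⟨continuous_const, by simp⟩
  · rintro F G - - ⟨hF, hF0⟩ ⟨hG, hG0⟩
    refine ⟨hF.add hG, ?_⟩
    simp only [Pi.add_apply, mul_add]
    rw [integral_add (hi F hF) (hi G hG), hF0, hG0, add_zero]
  · rintro c F - ⟨hF, hF0⟩
    refine ⟨hF.const_smul c, ?_⟩
    simp only [Pi.smul_apply, smul_eq_mul, mul_left_comm _ c]
    rw [integral_const_mul, hF0, mul_zero]

lemma setIntegral_disk_solid_eval_eq_zero {g : ℝ → ℝ}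
    (hg : IntegrableOn (fun q : ℝ × ℝ => g (q.1 ^ 2 + q.2 ^ 2)) disk) {m d : ℕ}
    (h0 : ∀ a, 2 * a + m ≤ d → ∫ r in (0 : ℝ)..1, g r * r ^ (m + a) = 0) (ε : Fin 2)
    {Q : MvPolynomial (Fin 2) ℝ} (hQ : Q.totalDegree ≤ d) :
    ∫ q in disk, g (q.1 ^ 2 + q.2 ^ 2) * solid m ε q.1 q.2 * MvPolynomial.eval ![q.1, q.2] Q = 0 := by
  rw [setIntegral_disk_solid hg m ε (continuous_eval Q),
    (setIntegral_disk_bidegree_eq_zero hg h0 (eval_mem_bidegreeSpan hQ)).2]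
  simp

/-- Writing the second harmonic through `z ^ m'` and its conjugate leaves two radial integrals; the
one with `z ^ (m + m')` survives only for `m = m' = 0`, which accounts for the exceptional means. -/
lemma setIntegral_disk_solid_mul_solid {g : ℝ → ℝ}
    (hg : IntegrableOn (fun q : ℝ × ℝ => g (q.1 ^ 2 + q.2 ^ 2)) disk) (m m' : ℕ) (ε ε' : Fin 2) :
    ∫ q in disk, g (q.1 ^ 2 + q.2 ^ 2) * solid m ε q.1 q.2 * solid m' ε' q.1 q.2 =
      if m = m' ∧ ε = ε' then solidMean m ε * (Real.pi * ∫ r in (0 : ℝ)..1, g r * r ^ m) else 0 := by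
  have hc : Continuous fun q => starRingEnd ℂ (toComplex q) :=
    Complex.continuous_conj.comp continuous_toComplex
  have h1 := setIntegral_disk_radial g (m + m') 0
  have h2 := setIntegral_disk_radial g m m'
  have i1 := integrableOn_mul_disk hg
    (F := fun q => toComplex q ^ (m + m') * starRingEnd ℂ (toComplex q) ^ 0) (by fun_prop)
  have i2 := integrableOn_mul_disk hg
    (F := fun q => toComplex q ^ m * starRingEnd ℂ (toComplex q) ^ m') (by fun_prop)
  have key (b c : ℂ) (F : ℝ × ℝ → ℝ) (hF : ∀ q, (F q : ℂ) =
      b * toComplex q ^ m' + c * starRingEnd ℂ (toComplex q) ^ m') :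
      ∫ q in disk, (g (q.1 ^ 2 + q.2 ^ 2) : ℂ) * (toComplex q ^ m * F q) =
      b * (if m + m' = 0 then ((Real.pi * ∫ r in (0 : ℝ)..1, g r * r ^ (m + m') : ℝ) : ℂ) else 0) +
      c * (if m = m' then ((Real.pi * ∫ r in (0 : ℝ)..1, g r * r ^ m : ℝ) : ℂ) else 0) := by
    rw [← h1, ← h2, ← integral_const_mul, ← integral_const_mul,
      ← integral_add (i1.const_mul _) (i2.const_mul _)]
    congr 1; ext q
    rw [hF, pow_add, pow_zero]; ring
  have hre (q : ℝ × ℝ) : ((solid m' 0 q.1 q.2 : ℝ) : ℂ) =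
      (1 / 2 : ℂ) * toComplex q ^ m' + (1 / 2 : ℂ) * starRingEnd ℂ (toComplex q) ^ m' := by
    have h := Complex.add_conj (toComplex q ^ m')
    rw [map_pow] at h
    rw [← mul_add, h]; simp [solid, toComplex]
  have him (q : ℝ × ℝ) : ((solid m' 1 q.1 q.2 : ℝ) : ℂ) =
      (-Complex.I / 2 : ℂ) * toComplex q ^ m' +
        (Complex.I / 2 : ℂ) * starRingEnd ℂ (toComplex q) ^ m' := by
    have h := Complex.sub_conj (toComplex q ^ m')
    rw [map_pow] at h
    have h' : ((solid m' 1 q.1 q.2 : ℝ) : ℂ) = ((toComplex q ^ m').im : ℂ) := by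
      simp [solid, toComplex]
    rw [h']
    push_cast at h
    linear_combination (Complex.I / 2) * h + ((toComplex q ^ m').im : ℂ) * Complex.I_mul_I
  have k0 := key _ _ _ hre
  have k1 := key _ _ _ him
  rw [setIntegral_disk_solid hg m ε (continuous_solid m' ε')]
  rw [solidMean]
  have hk : ∫ q in disk, (g (q.1 ^ 2 + q.2 ^ 2) : ℂ) *
      (toComplex q ^ m * (solid m' ε' q.1 q.2 : ℂ)) = if ε' = 0 then
        ∫ q in disk, (g (q.1 ^ 2 + q.2 ^ 2) : ℂ) * (toComplex q ^ m * (solid m' 0 q.1 q.2 : ℂ)) else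
        ∫ q in disk, (g (q.1 ^ 2 + q.2 ^ 2) : ℂ) * (toComplex q ^ m * (solid m' 1 q.1 q.2 : ℂ)) := by
    fin_cases ε' <;> rfl
  rw [hk, k0, k1]
  by_cases hm : m = m'
  · subst hm
    by_cases h0 : m = 0
    · subst h0
      fin_cases ε <;> fin_cases ε' <;> simp <;> ring
    · fin_cases ε <;> fin_cases ε' <;> simp [h0]
  · have : ¬ (m + m' = 0) := by omega
    simp only [hm, this, if_false, mul_zero, add_zero, ite_self, Complex.zero_re, Complex.zero_im,
      false_and]

/-! ### The polar basis as polynomials in two variables -/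

/-- Real and imaginary part of `(X + i Y) ^ m`. -/
def solidPair : ℕ → MvPolynomial (Fin 2) ℝ × MvPolynomial (Fin 2) ℝ
  | 0 => (1, 0)
  | m + 1 =>
    ((solidPair m).1 * MvPolynomial.X 0 - (solidPair m).2 * MvPolynomial.X 1,
      (solidPair m).1 * MvPolynomial.X 1 + (solidPair m).2 * MvPolynomial.X 0)

lemma eval_solidPair (m : ℕ) (x y : ℝ) :
    MvPolynomial.eval ![x, y] (solidPair m).1 = ((⟨x, y⟩ : ℂ) ^ m).re ∧
      MvPolynomial.eval ![x, y] (solidPair m).2 = ((⟨x, y⟩ : ℂ) ^ m).im := by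
  induction m with
  | zero => simp [solidPair]
  | succ m ih => simp [solidPair, pow_succ, ih.1, ih.2]

lemma totalDegree_solidPair (m : ℕ) :
    (solidPair m).1.totalDegree ≤ m ∧ (solidPair m).2.totalDegree ≤ m := by
  induction m with
  | zero => simp [solidPair]
  | succ m ih =>
    have h (p : MvPolynomial (Fin 2) ℝ) (i : Fin 2) (hp : p.totalDegree ≤ m) :
        (p * MvPolynomial.X i).totalDegree ≤ m + 1 :=
      (MvPolynomial.totalDegree_mul _ _).trans (by rw [MvPolynomial.totalDegree_X]; omega)
    exact ⟨(MvPolynomial.totalDegree_sub _ _).trans (max_le (h _ _ ih.1) (h _ _ ih.2)),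
      (MvPolynomial.totalDegree_add _ _).trans (max_le (h _ _ ih.1) (h _ _ ih.2))⟩

/-- `solid m ε` as a polynomial. -/
def solidPolynomial (m : ℕ) (ε : Fin 2) : MvPolynomial (Fin 2) ℝ :=
  if ε = 0 then (solidPair m).1 else (solidPair m).2

lemma eval_solidPolynomial (m : ℕ) (ε : Fin 2) (x y : ℝ) :
    MvPolynomial.eval ![x, y] (solidPolynomial m ε) = solid m ε x y := by
  rw [solidPolynomial, solid, ← (eval_solidPair m x y).1, ← (eval_solidPair m x y).2]
  split_ifs <;> rfl

lemma totalDegree_solidPolynomial (m : ℕ) (ε : Fin 2) :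
    (solidPolynomial m ε).totalDegree ≤ m := by
  rw [solidPolynomial]
  split_ifs
  exacts [(totalDegree_solidPair m).1, (totalDegree_solidPair m).2]

/-- The normalizing factor of `polarPoly`. -/
def polarScale (μ : ℝ) (k l : ℕ) : ℝ :=
  h μ l k / Real.sqrt (jacobiRatio (μ - 1 / 2) (k - 2 * l) l)

/-- `polarPoly μ k l ε` as a polynomial. -/
def polarPolynomial (μ : ℝ) (k l : ℕ) (ε : Fin 2) : MvPolynomial (Fin 2) ℝ :=
  MvPolynomial.C (polarScale μ k l) * (∑ j ∈ Finset.range (l + 1),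
    MvPolynomial.C (jacobiCoeff (μ - 1 / 2) (k - 2 * l : ℕ) l j) *
      (MvPolynomial.X 0 ^ 2 + MvPolynomial.X 1 ^ 2) ^ j) * solidPolynomial (k - 2 * l) ε

lemma eval_polarPolynomial (μ : ℝ) (k l : ℕ) (ε : Fin 2) (x y : ℝ) :
    MvPolynomial.eval ![x, y] (polarPolynomial μ k l ε) =
      polarScale μ k l * jacobi (μ - 1 / 2) (k - 2 * l : ℕ) l (2 * (x ^ 2 + y ^ 2) - 1) *
        solid (k - 2 * l) ε x y := by
  rw [polarPolynomial, map_mul, eval_solidPolynomial, jacobi_eq_sum_pow]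
  simp

lemma polarPoly_eq_eval {μ : ℝ} (hμ : 0 ≤ μ) (k l : ℕ) (ε : Fin 2) (x y : ℝ) :
    polarPoly μ k l ε x y = MvPolynomial.eval ![x, y] (polarPolynomial μ k l ε) := by
  rw [polarPoly, eval_polarPolynomial, jacobiOrthonormal_eq (by linarith), polarScale]
  ring

lemma totalDegree_polarPolynomial (μ : ℝ) {k l : ℕ} (hl : 2 * l ≤ k) (ε : Fin 2) :
    (polarPolynomial μ k l ε).totalDegree ≤ k := by
  have h1 : (MvPolynomial.X 0 ^ 2 + MvPolynomial.X 1 ^ 2 : MvPolynomial (Fin 2) ℝ).totalDegree ≤ 2 :=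
    (MvPolynomial.totalDegree_add _ _).trans (by simp [MvPolynomial.totalDegree_X_pow])
  have h2 : (∑ j ∈ Finset.range (l + 1),
      MvPolynomial.C (jacobiCoeff (μ - 1 / 2) (k - 2 * l : ℕ) l j) *
      (MvPolynomial.X 0 ^ 2 + MvPolynomial.X 1 ^ 2) ^ j :
        MvPolynomial (Fin 2) ℝ).totalDegree ≤ 2 * l := by
    refine MvPolynomial.totalDegree_finsetSum_le fun j hj => ?_
    refine (MvPolynomial.totalDegree_mul _ _).trans ?_
    rw [MvPolynomial.totalDegree_C, zero_add]
    refine (MvPolynomial.totalDegree_pow _ _).trans ?_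
    have := Finset.mem_range.1 hj
    nlinarith
  refine (MvPolynomial.totalDegree_mul _ _).trans ?_
  have h3 := MvPolynomial.totalDegree_mul (MvPolynomial.C (polarScale μ k l))
    (∑ j ∈ Finset.range (l + 1),
      MvPolynomial.C (jacobiCoeff (μ - 1 / 2) (k - 2 * l : ℕ) l j) *
      (MvPolynomial.X 0 ^ 2 + MvPolynomial.X 1 ^ 2) ^ j : MvPolynomial (Fin 2) ℝ)
  rw [MvPolynomial.totalDegree_C, zero_add] at h3
  have h4 := totalDegree_solidPolynomial (k - 2 * l) ε
  omega

lemma diskWeight_eq (μ x y : ℝ) :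
    diskWeight μ x y = (1 - (x ^ 2 + y ^ 2)) ^ (μ - 1 / 2) := by
  rw [diskWeight, sub_sub]

lemma integrableOn_radial {μ : ℝ} (hμ : 0 ≤ μ) {G : ℝ → ℝ} (hG : Continuous G) :
    IntegrableOn (fun q : ℝ × ℝ => (fun r => G r * (1 - r) ^ (μ - 1 / 2)) (q.1 ^ 2 + q.2 ^ 2)) disk := by
  have h := IntegrableOn.continuousOn_mul (g := fun q : ℝ × ℝ => G (q.1 ^ 2 + q.2 ^ 2))
    (by fun_prop) (integrableOn_diskWeight hμ) isCompact_disk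
  simpa only [diskWeight_eq] using h

lemma polarPolynomial_mem_orthPoly {μ : ℝ} (hμ : 0 ≤ μ) {k l : ℕ} (hl : 2 * l ≤ k) (ε : Fin 2) :
    polarPolynomial μ k l ε ∈ orthPoly μ k := by
  refine ⟨totalDegree_polarPolynomial μ hl ε, fun Q hQ => ?_⟩
  have hc := continuous_jacobi (μ - 1 / 2) (k - 2 * l : ℕ) l
  have h1 := setIntegral_disk_solid_eval_eq_zero (m := k - 2 * l) (d := k - 1)
    (g := fun r => polarScale μ k l *
      jacobi (μ - 1 / 2) (k - 2 * l : ℕ) l (2 * r - 1) * (1 - r) ^ (μ - 1 / 2))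
    (integrableOn_radial hμ (G := fun r => polarScale μ k l *
      jacobi (μ - 1 / 2) (k - 2 * l : ℕ) l (2 * r - 1)) (by fun_prop)) ?_ ε (Q := Q) (by omega)
  · rw [diskInner]
    convert mul_zero _
    rw [← h1]
    congr 1; ext q
    rw [eval_polarPolynomial, diskWeight_eq]; ring
  · intro b hb
    -- The bound `hb` gives `b < l` once `k` is positive; `hQ` rules out `k = 0`, where the
    -- truncated `k - 1` would be too large.
    have h2 := jacobi_moment_eq_zero (α := μ - 1 / 2) (by linarith) (k - 2 * l) (n := l) (b := b)
      (by omega)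
    refine Eq.trans ?_ ((intervalIntegral.integral_const_mul (polarScale μ k l) _).trans
      (by rw [h2, mul_zero]))
    congr 1; ext r; ring

lemma Gamma_add_nat {c : ℝ} (hc : 0 < c) (n : ℕ) :
    Real.Gamma (n + c) = poch c n * Real.Gamma c := by
  induction n with
  | zero => simp
  | succ n ih =>
    rw [poch_succ, show ((n + 1 : ℕ) : ℝ) + c = (n + c) + 1 by push_cast; ring,
      Real.Gamma_add_one (by positivity), ih]
    ring

lemma h_sq {μ : ℝ} (hμ : 0 ≤ μ) (l k : ℕ) :
    h μ l k ^ 2 = kappa l k * (poch (μ + 3 / 2) (k - 2 * l) / (k - 2 * l).factorial) := by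
  have hc : 0 < μ + 3 / 2 := by linarith
  have h1 := Gamma_add_nat hc (k - 2 * l)
  have h2 := Real.Gamma_pos_of_pos hc
  have h3 := poch_pos hc (k - 2 * l)
  have h4 := kappa_pos l k
  have h5 : Real.Gamma ((k - 2 * l : ℕ) + μ + 3 / 2) /
      (Real.Gamma (μ + 3 / 2) * Real.Gamma ((k - 2 * l : ℕ) + 1)) =
      poch (μ + 3 / 2) (k - 2 * l) / (k - 2 * l).factorial := by
    rw [add_assoc, h1, Real.Gamma_nat_eq_factorial]
    field_simp
  rw [h, h5, ← kappa, Real.sq_sqrt (by positivity)]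

/-- The orthonormality relations of the polar basis; the one with `2 l = k`, `ε = 1` vanishes. -/
lemma diskInner_polarPolynomial {μ : ℝ} (hμ : 0 ≤ μ) {k l l' : ℕ} (hl : 2 * l ≤ k)
    (hl' : 2 * l' ≤ k) (ε ε' : Fin 2) (hε : 2 * l = k → ε = 0) :
    diskInner μ (polarPolynomial μ k l ε) (polarPolynomial μ k l' ε') =
      if l = l' ∧ ε = ε' then 1 else 0 := by
  have hc := continuous_jacobi (μ - 1 / 2) (k - 2 * l : ℕ) l
  have hc' := continuous_jacobi (μ - 1 / 2) (k - 2 * l' : ℕ) l'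
  have h1 := setIntegral_disk_solid_mul_solid
    (g := fun r => (polarScale μ k l *
      jacobi (μ - 1 / 2) (k - 2 * l : ℕ) l (2 * r - 1)) * (polarScale μ k l' *
      jacobi (μ - 1 / 2) (k - 2 * l' : ℕ) l' (2 * r - 1)) * (1 - r) ^ (μ - 1 / 2))
    (integrableOn_radial hμ (G := fun r => (polarScale μ k l *
      jacobi (μ - 1 / 2) (k - 2 * l : ℕ) l (2 * r - 1)) * (polarScale μ k l' *
      jacobi (μ - 1 / 2) (k - 2 * l' : ℕ) l' (2 * r - 1))) (by fun_prop))
      (k - 2 * l) (k - 2 * l') ε ε'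
  have h2 : diskInner μ (polarPolynomial μ k l ε) (polarPolynomial μ k l' ε') = a μ *
      ∫ q in disk, (fun r => (polarScale μ k l *
      jacobi (μ - 1 / 2) (k - 2 * l : ℕ) l (2 * r - 1)) * (polarScale μ k l' *
      jacobi (μ - 1 / 2) (k - 2 * l' : ℕ) l' (2 * r - 1)) * (1 - r) ^ (μ - 1 / 2))
        (q.1 ^ 2 + q.2 ^ 2) * solid (k - 2 * l) ε q.1 q.2 * solid (k - 2 * l') ε' q.1 q.2 := by
    rw [diskInner]
    congr 2; ext q
    rw [eval_polarPolynomial, eval_polarPolynomial, diskWeight_eq]; ring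
  have hm : k - 2 * l = k - 2 * l' ↔ l = l' := by omega
  rw [h2, h1]
  simp only [hm]
  split_ifs with hcond
  · obtain ⟨rfl, rfl⟩ := hcond
    set m := k - 2 * l with hmdef
    have h3 : ∫ r in (0 : ℝ)..1, polarScale μ k l * jacobi (μ - 1 / 2) m l (2 * r - 1) *
        (polarScale μ k l * jacobi (μ - 1 / 2) m l (2 * r - 1)) * (1 - r) ^ (μ - 1 / 2) * r ^ m =
        polarScale μ k l ^ 2 * jacobiSq (μ - 1 / 2) m l := by
      rw [jacobiSq, ← intervalIntegral.integral_const_mul]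
      congr 1; ext r; ring
    have hα : -1 < μ - 1 / 2 := by linarith
    have h4 : polarScale μ k l ^ 2 = h μ l k ^ 2 / jacobiRatio (μ - 1 / 2) m l := by
      rw [polarScale, div_pow, Real.sq_sqrt (jacobiRatio_pos hα _ _).le]
    -- The factor `kappa` in `h` compensates the angular mean. At `2 l = k` this needs `ε = 0`, the
    -- sine harmonic being zero there.
    have h5 : solidMean m ε = 1 / kappa l k := by
      rw [solidMean, kappa]
      rcases hl.lt_or_eq with h | h
      · rw [if_neg (by omega), if_pos h]
      · rw [if_pos (by omega), if_pos (hε h), if_neg (by omega)]; norm_num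
    have h6 := jacobiSq_pos hα m l
    have h7 := kappa_pos l k
    have h8 := poch_pos (c := μ + 3 / 2) (by linarith) m
    have h9 : (0 : ℝ) < μ + 1 / 2 := by linarith
    rw [h3, h4, h_sq hμ, h5, jacobiRatio, a, show μ - 1 / 2 + 1 = μ + 1 / 2 by ring, poch_succ_left,
      show μ + 1 / 2 + 1 = μ + 3 / 2 by ring, ← hmdef]
    have := Real.pi_pos
    generalize jacobiSq (μ - 1 / 2) m l = J at h6 ⊢
    generalize poch (μ + 3 / 2) m = c at h8 ⊢
    field_simp
  · exact mul_zero _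

/-! ### The reproducing kernel -/

lemma diskInner_comm (μ : ℝ) (P Q : MvPolynomial (Fin 2) ℝ) :
    diskInner μ P Q = diskInner μ Q P := by
  rw [diskInner, diskInner]
  congr 2; ext q; ring

lemma integrableOn_eval_mul_eval {μ : ℝ} (hμ : 0 ≤ μ) (P Q : MvPolynomial (Fin 2) ℝ) :
    IntegrableOn (fun q : ℝ × ℝ => MvPolynomial.eval ![q.1, q.2] P *
      MvPolynomial.eval ![q.1, q.2] Q * diskWeight μ q.1 q.2) disk :=
  IntegrableOn.continuousOn_mul ((continuous_eval P).mul (continuous_eval Q)).continuousOn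
    (integrableOn_diskWeight hμ) isCompact_disk

lemma diskInner_sum_smul {ι : Type*} [Fintype ι] {μ : ℝ} (hμ : 0 ≤ μ) (c : ι → ℝ)
    (P : ι → MvPolynomial (Fin 2) ℝ) (Q : MvPolynomial (Fin 2) ℝ) :
    diskInner μ (∑ j, c j • P j) Q = ∑ j, c j * diskInner μ (P j) Q := by
  have h (q : ℝ × ℝ) : MvPolynomial.eval ![q.1, q.2] (∑ j, c j • P j) *
      MvPolynomial.eval ![q.1, q.2] Q * diskWeight μ q.1 q.2 =
      ∑ j, c j * (MvPolynomial.eval ![q.1, q.2] (P j) * MvPolynomial.eval ![q.1, q.2] Q *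
        diskWeight μ q.1 q.2) := by
    rw [map_sum, Finset.sum_mul, Finset.sum_mul]
    refine Finset.sum_congr rfl fun j _ => ?_
    rw [MvPolynomial.smul_eval]; ring
  simp only [diskInner, h]
  rw [integral_finsetSum _ fun j _ => (integrableOn_eval_mul_eval hμ (P j) Q).const_mul (c j),
    Finset.mul_sum]
  refine Finset.sum_congr rfl fun j _ => ?_
  rw [integral_const_mul]; ring

/-- The matrix `U` expressing `e` in the basis `P` has orthonormal rows. Being square, it also
satisfies `Uᵀ U = 1`, so the dot product of values is preserved. Thus only `P` has to be known to
span. -/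
lemma IsOrthonormalBasis.sum_eval_mul_eval {μ : ℝ} (hμ : 0 ≤ μ) {k : ℕ}
    {P e : Fin (k + 1) → MvPolynomial (Fin 2) ℝ} (hP : IsOrthonormalBasis μ k P)
    (he : ∀ j, e j ∈ orthPoly μ k)
    (he' : ∀ i j, diskInner μ (e i) (e j) = if i = j then 1 else 0) (x y : Fin 2 → ℝ) :
    ∑ j, MvPolynomial.eval x (P j) * MvPolynomial.eval y (P j) =
      ∑ j, MvPolynomial.eval x (e j) * MvPolynomial.eval y (e j) := by
  choose U hU using fun i => (Submodule.mem_span_range_iff_exists_fun ℝ).1 (hP.span _ (he i))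
  have h1 : (Matrix.of U) * (Matrix.of U).transpose = 1 := by
    ext i i'
    have h := he' i i'
    rw [← hU i, ← hU i', diskInner_sum_smul hμ] at h
    rw [Matrix.mul_apply, Matrix.one_apply, ← h]
    refine Finset.sum_congr rfl fun j _ => ?_
    rw [diskInner_comm, diskInner_sum_smul hμ]
    simp [hP.orthonormal]
  have h2 := mul_eq_one_comm.1 h1
  have h3 (z : Fin 2 → ℝ) : (fun i => MvPolynomial.eval z (e i)) =
      Matrix.mulVec (Matrix.of U) (fun j => MvPolynomial.eval z (P j)) := by
    ext i
    rw [← hU i, map_sum]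
    simp [Matrix.mulVec, dotProduct, MvPolynomial.smul_eval]
  change _ = (fun i => MvPolynomial.eval x (e i)) ⬝ᵥ (fun i => MvPolynomial.eval y (e i))
  rw [h3, h3, Matrix.dotProduct_mulVec, Matrix.vecMul_mulVec, h2, Matrix.vecMul_one]
  rfl

/-- An enumeration of the polar basis. -/
def polarFamily (μ : ℝ) (k j : ℕ) : MvPolynomial (Fin 2) ℝ :=
  if 2 * j ≤ k then polarPolynomial μ k j 0 else polarPolynomial μ k (k - j) 1

lemma polarFamily_mem_orthPoly {μ : ℝ} (hμ : 0 ≤ μ) {k j : ℕ} (hj : j ≤ k) :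
    polarFamily μ k j ∈ orthPoly μ k := by
  rw [polarFamily]
  split_ifs
  · exact polarPolynomial_mem_orthPoly hμ (by omega) _
  · exact polarPolynomial_mem_orthPoly hμ (by omega) _

lemma diskInner_polarFamily {μ : ℝ} (hμ : 0 ≤ μ) {k i j : ℕ} (hi : i ≤ k) (hj : j ≤ k) :
    diskInner μ (polarFamily μ k i) (polarFamily μ k j) = if i = j then 1 else 0 := by
  rw [polarFamily, polarFamily]
  split_ifs with h1 h2 h3 h3 h4 h5 h5 <;>
    rw [diskInner_polarPolynomial hμ (by omega) (by omega) _ _ (by first | exact fun _ => rfl | (intro h; omega))] <;>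
    simp <;> omega

lemma solid_zero_one (x y : ℝ) : solid 0 1 x y = 0 := by simp [solid]

lemma polarPolynomial_eq_zero (μ : ℝ) {k l : ℕ} (hl : 2 * l = k) (x y : ℝ) :
    MvPolynomial.eval ![x, y] (polarPolynomial μ k l 1) = 0 := by
  rw [eval_polarPolynomial, show k - 2 * l = 0 by omega, solid_zero_one, mul_zero]

/-- Folding the enumeration pairs the cosine element `l` with the sine element at index `k - l`. For
`2 l = k` there is no partner, in accordance with the vanishing sine element. -/
lemma sum_eval_eq_sum_polarPolynomial {μ : ℝ} (hμ : 0 ≤ μ) {k : ℕ}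
    {P : Fin (k + 1) → MvPolynomial (Fin 2) ℝ} (hP : IsOrthonormalBasis μ k P)
    (x₁ x₂ y₁ y₂ : ℝ) :
    ∑ j, MvPolynomial.eval ![x₁, x₂] (P j) * MvPolynomial.eval ![y₁, y₂] (P j) =
      ∑ l ∈ Finset.range (k / 2 + 1), ∑ ε : Fin 2,
        MvPolynomial.eval ![x₁, x₂] (polarPolynomial μ k l ε) *
          MvPolynomial.eval ![y₁, y₂] (polarPolynomial μ k l ε) := by
  rw [hP.sum_eval_mul_eval hμ (e := fun j => polarFamily μ k j)
    (fun j => polarFamily_mem_orthPoly hμ (Nat.lt_succ_iff.1 j.2))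
    (fun i j => by
      rw [diskInner_polarFamily hμ (Nat.lt_succ_iff.1 i.2) (Nat.lt_succ_iff.1 j.2)]
      simp only [Fin.ext_iff]),
    Fin.sum_univ_eq_sum_range (fun j => MvPolynomial.eval ![x₁, x₂] (polarFamily μ k j) *
      MvPolynomial.eval ![y₁, y₂] (polarFamily μ k j)), sum_range_fold]
  refine Finset.sum_congr rfl fun l hl => ?_
  have hl' : 2 * l ≤ k := by have := Finset.mem_range.1 hl; omega
  rw [Fin.sum_univ_two, polarFamily, if_pos hl']
  congr 1
  split_ifs with h
  · rw [polarFamily, if_neg (by omega), Nat.sub_sub_self (by omega)]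
  · rw [polarPolynomial_eq_zero μ (by omega), zero_mul]

/-- The factors are those of the Gegenbauer prefactor, of the ridge expansion and of the Jacobi
polynomial at `1`. -/
lemma lambda_mul {μ : ℝ} (hμ : 0 ≤ μ) (k l : ℕ) :
    (k + μ + 1 / 2) / (μ + 1 / 2) * (poch (μ + 1 / 2) (k - l) / (k - l).factorial) *
      lambda μ l k * (poch (μ + 1 / 2) l / l.factorial) = 1 := by
  have h1 := poch_succ (μ + 1 / 2) (k - l)
  rw [poch_succ_left, show μ + 1 / 2 + 1 = μ + 3 / 2 by ring] at h1
  have h0 : 0 < μ + 1 / 2 := by linarith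
  have h2 : poch (μ + 3 / 2) (k - l) =
      poch (μ + 1 / 2) (k - l) * (μ + 1 / 2 + (k - l : ℕ)) / (μ + 1 / 2) := by
    rw [← h1]; field_simp
  have h3 := poch_pos h0 (k - l)
  have h4 := poch_pos h0 l
  rw [lambda, h2, add_assoc (k : ℝ), add_assoc ((k - l : ℕ) : ℝ),
    add_comm (μ + 1 / 2) ((k - l : ℕ) : ℝ)]
  generalize poch (μ + 1 / 2) (k - l) = p at h3 ⊢
  generalize poch (μ + 1 / 2) l = q at h4 ⊢
  generalize μ + 1 / 2 = s at h0 ⊢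
  have h5 : (0 : ℝ) < k + s := by positivity
  have h6 : (0 : ℝ) < (k - l : ℕ) + s := by positivity
  field_simp

/-- The frequencies `k - 2 l` share the parity of `k` and are at most `n`, so discrete orthogonality
removes every off-diagonal product. -/
lemma sum_mul_sum_solid (n k : ℕ) (hk : k ≤ n) (α β : ℕ → Fin 2 → ℝ) :
    ∑ ν ∈ Finset.range (n + 1),
      (∑ l ∈ Finset.range (k / 2 + 1), ∑ ε : Fin 2,
        α l ε * solid (k - 2 * l) ε (Real.cos (angle n ν)) (Real.sin (angle n ν))) *
      (∑ l ∈ Finset.range (k / 2 + 1), ∑ ε : Fin 2,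
        β l ε * solid (k - 2 * l) ε (Real.cos (angle n ν)) (Real.sin (angle n ν))) =
      (n + 1) * ∑ l ∈ Finset.range (k / 2 + 1), ∑ ε : Fin 2,
        α l ε * β l ε * solidMean (k - 2 * l) ε := by
  simp only [← Finset.sum_product']
  simp only [Finset.sum_mul_sum]
  rw [Finset.sum_comm, Finset.mul_sum]
  refine Finset.sum_congr rfl fun u hu => ?_
  rw [Finset.sum_comm, Finset.sum_eq_single u]
  · have h := sum_solid_mul_solid n (k - 2 * u.1) (k - 2 * u.1) u.2 u.2 (by omega) (by omega)
      (by omega)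
    rw [if_pos ⟨rfl, rfl⟩] at h
    rw [show (n + 1) * (α u.1 u.2 * β u.1 u.2 * solidMean (k - 2 * u.1) u.2) =
      α u.1 u.2 * β u.1 u.2 * ((n + 1) * solidMean (k - 2 * u.1) u.2) by ring, ← h, Finset.mul_sum]
    refine Finset.sum_congr rfl fun ν _ => by ring
  · intro v hv huv
    have hu' := Finset.mem_range.1 (Finset.mem_product.1 hu).1
    have hv' := Finset.mem_range.1 (Finset.mem_product.1 hv).1
    have h := sum_solid_mul_solid n (k - 2 * u.1) (k - 2 * v.1) u.2 v.2 (by omega) (by omega)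
      (by omega)
    rw [if_neg] at h
    · rw [← mul_zero (α u.1 u.2 * β v.1 v.2), ← h, Finset.mul_sum]
      refine Finset.sum_congr rfl fun ν _ => by ring
    · rintro ⟨h1, h2⟩
      exact huv (Prod.ext (by omega) h2.symm)
  · exact fun h => absurd hu h

lemma sum_kernelDt {μ : ℝ} (hμ : 0 ≤ μ) {n k : ℕ} (hk : k ≤ n) (x₁ x₂ y₁ y₂ : ℝ) :
    ∑ ν ∈ Finset.range (n + 1), kernelDt μ k (angle n ν)
      (y₁ * Real.cos (angle n ν) + y₂ * Real.sin (angle n ν)) x₁ x₂ =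
      (n + 1) * ∑ l ∈ Finset.range (k / 2 + 1), ∑ ε : Fin 2,
        MvPolynomial.eval ![y₁, y₂] (polarPolynomial μ k l ε) *
          MvPolynomial.eval ![x₁, x₂] (polarPolynomial μ k l ε) := by
  have h1 (ν : ℕ) : kernelD μ k (angle n ν) x₁ x₂ =
      ∑ l ∈ Finset.range (k / 2 + 1), ∑ ε : Fin 2,
        (lambda μ l k * (polarScale μ k l * (poch (μ + 1 / 2) l / l.factorial)) *
          MvPolynomial.eval ![x₁, x₂] (polarPolynomial μ k l ε)) *
          solid (k - 2 * l) ε (Real.cos (angle n ν)) (Real.sin (angle n ν)) := by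
    rw [kernelD]
    refine Finset.sum_congr rfl fun l _ => Finset.sum_congr rfl fun ε _ => ?_
    rw [polarPoly_eq_eval hμ, polarPoly_eq_eval hμ, eval_polarPolynomial μ k l ε (Real.cos _),
      Real.cos_sq_add_sin_sq, show (2 : ℝ) * 1 - 1 = 1 by norm_num, jacobi_one,
      show μ - 1 / 2 + 1 = μ + 1 / 2 by ring]
    ring
  simp only [kernelDt, gegenbauer_ridge, h1, mul_assoc ((k + μ + 1 / 2) / (μ + 1 / 2))]
  rw [← Finset.mul_sum, sum_mul_sum_solid n k hk, mul_left_comm, Finset.mul_sum]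
  congr 1
  refine Finset.sum_congr rfl fun l hl => ?_
  have hl' : 2 * l ≤ k := by have := Finset.mem_range.1 hl; omega
  rw [Finset.mul_sum]
  refine Finset.sum_congr rfl fun ε _ => ?_
  have hlam := lambda_mul hμ k l
  -- The multiplicity cancels the mean except for the zero-frequency sine, where the term itself
  -- vanishes.
  have hcases : solid (k - 2 * l) ε y₁ y₂ = 0 ∨ kappa l k * solidMean (k - 2 * l) ε = 1 := by
    rcases hl'.lt_or_eq with h | h
    · right
      rw [kappa, solidMean, if_pos h, if_neg (by omega)]; norm_num
    · rw [show k - 2 * l = 0 by omega]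
      fin_cases ε
      · right; simp [kappa, solidMean, h]
      · left; exact solid_zero_one _ _
  rw [eval_polarPolynomial μ k l ε y₁, show μ + 1 / 2 - 1 = μ - 1 / 2 by ring]
  rcases hcases with h | h
  · rw [h]; ring
  · generalize MvPolynomial.eval ![x₁, x₂] (polarPolynomial μ k l ε) = X
    generalize jacobi (μ - 1 / 2) (k - 2 * l : ℕ) l (2 * (y₁ ^ 2 + y₂ ^ 2) - 1) = J
    calc _ = ((k + μ + 1 / 2) / (μ + 1 / 2) * (poch (μ + 1 / 2) (k - l) / (k - l).factorial) *
          lambda μ l k * (poch (μ + 1 / 2) l / l.factorial)) *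
          (kappa l k * solidMean (k - 2 * l) ε) *
          (polarScale μ k l * J * solid (k - 2 * l) ε y₁ y₂ * X) := by ring
      _ = _ := by rw [hlam, h]; ring

/-- The sum of the ridge kernels over the equidistributed angles reproduces the kernel of the
orthogonal projection onto the polynomials of degree `k`. -/
lemma IsOrthonormalBasis.sum_kernelDt {μ : ℝ} (hμ : 0 ≤ μ) {n k : ℕ} (hk : k ≤ n)
    {P : Fin (k + 1) → MvPolynomial (Fin 2) ℝ} (hP : IsOrthonormalBasis μ k P)
    (x₁ x₂ y₁ y₂ : ℝ) :
    ∑ ν ∈ Finset.range (n + 1), kernelDt μ k (angle n ν)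
      (y₁ * Real.cos (angle n ν) + y₂ * Real.sin (angle n ν)) x₁ x₂ =
      (n + 1) * ∑ j, MvPolynomial.eval ![y₁, y₂] (P j) * MvPolynomial.eval ![x₁, x₂] (P j) := by
  rw [sum_eval_eq_sum_polarPolynomial hμ hP, CylinderRadon.sum_kernelDt hμ hk]

/-! ### Integration over the cylinder -/

lemma isCompact_cylinder (L : ℝ) : IsCompact (cylinder L) := by
  have h : cylinder L = (fun z : (ℝ × ℝ) × ℝ => (z.1.1, z.1.2, z.2)) '' (disk ×ˢ Set.Icc 0 L) := by
    ext ⟨x, y, z⟩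
    constructor
    · rintro ⟨h1, h2⟩
      exact ⟨((x, y), z), ⟨h1, h2⟩, rfl⟩
    · rintro ⟨⟨⟨x, y⟩, z⟩, ⟨h1, h2⟩, h⟩
      cases h
      exact ⟨h1, h2⟩
  rw [h]
  exact (isCompact_disk.prod isCompact_Icc).image (by fun_prop)

lemma measurableSet_cylinder (L : ℝ) : MeasurableSet (cylinder L) :=
  (isCompact_cylinder L).measurableSet

lemma diskWeight_nonneg (μ : ℝ) {x y : ℝ} (h : x ^ 2 + y ^ 2 ≤ 1) : 0 ≤ diskWeight μ x y :=
  Real.rpow_nonneg (by linarith) _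

lemma integrableOn_cylinderWeight {μ L : ℝ} (hμ : 0 ≤ μ) {WL : ℝ → ℝ} (hWL : IsWeight L WL) :
    IntegrableOn (cylinderWeight μ WL) (cylinder L) := by
  have h1 : Integrable (fun z : (ℝ × ℝ) × ℝ => diskWeight μ z.1.1 z.1.2 * WL z.2)
      ((volume.restrict disk).prod (volume.restrict (Set.Icc 0 L))) :=
    Integrable.mul_prod (f := fun q : ℝ × ℝ => diskWeight μ q.1 q.2) (g := WL)
      (integrableOn_diskWeight hμ) hWL.integrable
  rw [Measure.prod_restrict, ← Measure.volume_eq_prod] at h1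
  have h2 := (volume_preserving_prodAssoc (α₁ := ℝ) (β₁ := ℝ) (γ₁ := ℝ)).integrableOn_comp_preimage
    MeasurableEquiv.prodAssoc.measurableEmbedding (f := cylinderWeight μ WL) (s := cylinder L)
  exact h2.1 h1

/-- The weighted measure is finite, so `L²` is contained in `L¹`; the remaining argument uses only
this integrability of `f`. -/
lemma integrableOn_mul_cylinderWeight {μ L : ℝ} (hμ : 0 ≤ μ) {WL : ℝ → ℝ} (hWL : IsWeight L WL)
    {f : ℝ × ℝ × ℝ → ℝ} (hf : MemLp f 2 (cylinderMeasure μ L WL)) :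
    IntegrableOn (fun q => f q * cylinderWeight μ WL q) (cylinder L) := by
  have hW := integrableOn_cylinderWeight hμ hWL
  have : IsFiniteMeasure (cylinderMeasure μ L WL) := isFiniteMeasure_withDensity_ofReal hW.2
  have h1 := hf.integrable one_le_two
  rw [cylinderMeasure, integrable_withDensity_iff_integrable_smul₀'
    hW.aestronglyMeasurable.aemeasurable.ennreal_ofReal (by simp)] at h1
  refine (integrableOn_congr_fun (fun q hq => ?_) (measurableSet_cylinder L)).1 h1
  rw [ENNReal.toReal_ofReal, smul_eq_mul, mul_comm]
  exact mul_nonneg (diskWeight_nonneg μ hq.1) (hWL.nonneg _ hq.2)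

/-- Rotation by `θ` in the first two coordinates, with source coordinates `(t, w, s)`. -/
def cylinderRotation (θ : ℝ) (z : ℝ × ℝ × ℝ) : ℝ × ℝ × ℝ :=
  (z.1 * Real.cos θ - z.2.2 * Real.sin θ, z.1 * Real.sin θ + z.2.2 * Real.cos θ, z.2.1)

/-- This is multiplication by `e^{iθ}`, an isometry of the complex plane. -/
lemma measurePreserving_planeRotation (θ : ℝ) :
    MeasurePreserving (fun q : ℝ × ℝ =>
      (q.1 * Real.cos θ - q.2 * Real.sin θ, q.1 * Real.sin θ + q.2 * Real.cos θ)) := by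
  have h := (Complex.volume_preserving_equiv_real_prod.comp
    (rotation (Circle.exp θ)).measurePreserving).comp
      Complex.volume_preserving_equiv_real_prod.symm
  convert h using 1
  ext q
  · simp [Complex.measurableEquivRealProd, Complex.exp_ofReal_mul_I_re,
      Complex.exp_ofReal_mul_I_im]; ring
  · simp [Complex.measurableEquivRealProd, Complex.exp_ofReal_mul_I_re,
      Complex.exp_ofReal_mul_I_im]; ring

lemma measurePreserving_cylinderRotation (θ : ℝ) : MeasurePreserving (cylinderRotation θ) := by
  have h1 : MeasurePreserving (Prod.map id Prod.swap : ℝ × ℝ × ℝ → ℝ × ℝ × ℝ) :=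
    (MeasurePreserving.id volume).prod (Measure.measurePreserving_swap)
  have h2 := (volume_preserving_prodAssoc (α₁ := ℝ) (β₁ := ℝ) (γ₁ := ℝ))
  have h3 : MeasurePreserving (Prod.map (fun q : ℝ × ℝ =>
      (q.1 * Real.cos θ - q.2 * Real.sin θ, q.1 * Real.sin θ + q.2 * Real.cos θ)) id :
        (ℝ × ℝ) × ℝ → (ℝ × ℝ) × ℝ) :=
    (measurePreserving_planeRotation θ).prod (MeasurePreserving.id volume)
  exact h2.comp (h3.comp (h2.symm.comp h1))

lemma cylinderRotation_mem (θ L : ℝ) (t w s : ℝ) :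
    cylinderRotation θ (t, w, s) ∈ cylinder L ↔ t ^ 2 + s ^ 2 ≤ 1 ∧ w ∈ Set.Icc 0 L := by
  have h : (t * Real.cos θ - s * Real.sin θ) ^ 2 + (t * Real.sin θ + s * Real.cos θ) ^ 2 =
      t ^ 2 + s ^ 2 := by
    linear_combination (t ^ 2 + s ^ 2) * Real.cos_sq_add_sin_sq θ
  simp only [cylinder, cylinderRotation, Set.mem_ofPred_eq, h, Set.mem_Icc]

/-- Integration over the cylinder by slices orthogonal to the direction `θ`. -/
lemma integral_radon (μ θ L : ℝ) (hL : 0 ≤ L) (WL : ℝ → ℝ) (f : ℝ × ℝ × ℝ → ℝ) (ψ : ℝ → ℝ → ℝ)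
    (hi : IntegrableOn (fun q => f q * cylinderWeight μ WL q *
      ψ q.2.2 (q.1 * Real.cos θ + q.2.1 * Real.sin θ)) (cylinder L)) :
    ∫ t in (-1 : ℝ)..1, ∫ w in (0 : ℝ)..L,
      radon μ θ (fun q => f (q.1, q.2, w)) t * ψ w t * WL w =
      ∫ q in cylinder L, f q * cylinderWeight μ WL q *
        ψ q.2.2 (q.1 * Real.cos θ + q.2.1 * Real.sin θ) := by
  set F : ℝ × ℝ × ℝ → ℝ := fun q => f q * cylinderWeight μ WL q *
      ψ q.2.2 (q.1 * Real.cos θ + q.2.1 * Real.sin θ) with hF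
  have hT := measurePreserving_cylinderRotation θ
  have hind : Integrable ((cylinder L).indicator F) := hi.integrable_indicator (measurableSet_cylinder L)
  have hK : Integrable (fun z => (cylinder L).indicator F (cylinderRotation θ z)) :=
    hT.integrable_comp_of_integrable hind
  have hint : ∫ q in cylinder L, F q =
      ∫ z, (cylinder L).indicator F (cylinderRotation θ z) := by
    rw [← integral_indicator (measurableSet_cylinder L), ← integral_map hT.aemeasurable
      (by rw [hT.map_eq]; exact hind.aestronglyMeasurable), hT.map_eq]
  rw [hint, Measure.volume_eq_prod, integral_prod _ hK,
    intervalIntegral.integral_of_le (by norm_num), ← integral_indicator measurableSet_Ioc]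
  refine integral_congr_ae ?_
  -- The first set makes the slice at `t` integrable, for the second use of Fubini. The point `-1`
  -- is discarded because it lies outside `Ioc` although its slice can meet the cylinder.
  filter_upwards [hK.prod_right_ae, Measure.ae_ne volume (-1 : ℝ)] with t ht ht1
  by_cases hmem : t ∈ Set.Ioc (-1 : ℝ) 1
  · have ht2 : 0 ≤ 1 - t ^ 2 := by nlinarith [hmem.1, hmem.2]
    rw [Set.indicator_of_mem hmem, Measure.volume_eq_prod, integral_prod _ ht,
      intervalIntegral.integral_of_le hL, ← integral_Icc_eq_integral_Ioc,
      ← integral_indicator measurableSet_Icc]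
    congr 1; ext w
    by_cases hw : w ∈ Set.Icc 0 L
    · rw [Set.indicator_of_mem hw, radon, mul_assoc, ← intervalIntegral.integral_mul_const,
        intervalIntegral.integral_of_le (by linarith [Real.sqrt_nonneg (1 - t ^ 2)]),
        ← integral_Icc_eq_integral_Ioc, ← integral_indicator measurableSet_Icc]
      congr 1; ext s
      have hs : cylinderRotation θ (t, w, s) ∈ cylinder L ↔
          s ∈ Set.Icc (-Real.sqrt (1 - t ^ 2)) (Real.sqrt (1 - t ^ 2)) :=
        (cylinderRotation_mem θ L t w s).trans
          ⟨fun h => (Real.sq_le ht2).1 (by linarith [h.1]),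
            fun h => ⟨by linarith [(Real.sq_le ht2).2 h], hw⟩⟩
      by_cases hs' : s ∈ Set.Icc (-Real.sqrt (1 - t ^ 2)) (Real.sqrt (1 - t ^ 2))
      · rw [Set.indicator_of_mem hs', Set.indicator_of_mem (hs.2 hs')]
        have e : (t * Real.cos θ - s * Real.sin θ) * Real.cos θ +
            (t * Real.sin θ + s * Real.cos θ) * Real.sin θ = t := by
          linear_combination t * Real.cos_sq_add_sin_sq θ
        simp only [hF, cylinderRotation, cylinderWeight, e]
        ring
      · rw [Set.indicator_of_notMem hs', Set.indicator_of_notMem (mt hs.1 hs')]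
    · rw [Set.indicator_of_notMem hw]
      symm
      refine integral_eq_zero_of_ae (Filter.Eventually.of_forall fun s => ?_)
      exact Set.indicator_of_notMem (fun h => hw ((cylinderRotation_mem θ L t w s).1 h).2) _
  · rw [Set.indicator_of_notMem hmem]
    symm
    refine integral_eq_zero_of_ae (Filter.Eventually.of_forall fun ⟨w, s⟩ => ?_)
    refine Set.indicator_of_notMem (fun h => hmem ?_) _
    have h1 := ((cylinderRotation_mem θ L t w s).1 h).1
    have h2 : |t| ≤ 1 := abs_le_one_iff_mul_self_le_one.2 (by nlinarith [sq_nonneg s])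
    exact ⟨lt_of_le_of_ne (abs_le.1 h2).1 (Ne.symm ht1), (abs_le.1 h2).2⟩

/-! ### The partial sums as integrals against a kernel -/

lemma continuous_Phi (μ : ℝ) (p : ℕ → Polynomial ℝ) (n : ℕ) (ξ : ℝ) (x : ℝ × ℝ × ℝ) :
    Continuous fun q : ℝ × ℝ × ℝ =>
      Phi μ p n ξ q.2.2 (q.1 * Real.cos ξ + q.2.1 * Real.sin ξ) x := by
  have h (l : ℕ) : Continuous fun q : ℝ × ℝ × ℝ => (p l).eval q.2.2 :=
    (p l).continuous.comp (by fun_prop)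
  unfold Phi kernelDt gegenbauer
  fun_prop

lemma continuous_cylinderPoly (P : (k : ℕ) → Fin (k + 1) → MvPolynomial (Fin 2) ℝ)
    (p : ℕ → Polynomial ℝ) (l k : ℕ) (j : Fin (k + 1)) :
    Continuous (cylinderPoly P p l k j) := by
  have h1 : Continuous fun q : ℝ × ℝ × ℝ => (p (l - k)).eval q.2.2 :=
    (p (l - k)).continuous.comp (by fun_prop)
  have h2 : Continuous fun q : ℝ × ℝ × ℝ => MvPolynomial.eval ![q.1, q.2.1] (P k j) :=
    continuous_eval_pair continuous_fst continuous_snd.fst (P k j)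
  exact h2.mul h1

/-- Setting `i = l - k` turns the triangle `k ≤ l ≤ n` into `k ≤ n`, `i ≤ n - k`, and the disk and
height factors separate. -/
lemma sum_cylinderPoly (P : (k : ℕ) → Fin (k + 1) → MvPolynomial (Fin 2) ℝ)
    (p : ℕ → Polynomial ℝ) (n : ℕ) (q x : ℝ × ℝ × ℝ) :
    ∑ l ∈ Finset.range (n + 1), ∑ k ∈ Finset.range (l + 1), ∑ j : Fin (k + 1),
      cylinderPoly P p l k j q * cylinderPoly P p l k j x =
    ∑ k ∈ Finset.range (n + 1), (∑ j : Fin (k + 1),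
      MvPolynomial.eval ![q.1, q.2.1] (P k j) * MvPolynomial.eval ![x.1, x.2.1] (P k j)) *
        ∑ l ∈ Finset.range (n - k + 1), (p l).eval q.2.2 * (p l).eval x.2.2 := by
  have h := Finset.sum_range_diag_flip (n + 1) (fun k i => ∑ j : Fin (k + 1),
    MvPolynomial.eval ![q.1, q.2.1] (P k j) * (p i).eval q.2.2 *
      (MvPolynomial.eval ![x.1, x.2.1] (P k j) * (p i).eval x.2.2))
  simp only [cylinderPoly]
  rw [h]
  refine Finset.sum_congr rfl fun k hk => ?_
  have hk' := Finset.mem_range.1 hk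
  rw [Finset.sum_mul_sum, Finset.sum_comm, show n + 1 - k = n - k + 1 by omega]
  refine Finset.sum_congr rfl fun j _ => Finset.sum_congr rfl fun i _ => by ring

/-- The pointwise identity of kernels to which the theorem reduces;
`IsOrthonormalBasis.sum_kernelDt` applies to each `k ≤ n` with the same `n + 1` angles. -/
lemma sum_Phi {μ : ℝ} (hμ : 0 ≤ μ) {P : (k : ℕ) → Fin (k + 1) → MvPolynomial (Fin 2) ℝ}
    (hP : ∀ k, IsOrthonormalBasis μ k (P k)) (p : ℕ → Polynomial ℝ) (n : ℕ) (q x : ℝ × ℝ × ℝ) :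
    ∑ ν ∈ Finset.range (n + 1), Phi μ p n (angle n ν) q.2.2
      (q.1 * Real.cos (angle n ν) + q.2.1 * Real.sin (angle n ν)) x =
    (n + 1) * ∑ l ∈ Finset.range (n + 1), ∑ k ∈ Finset.range (l + 1), ∑ j : Fin (k + 1),
      cylinderPoly P p l k j q * cylinderPoly P p l k j x := by
  rw [sum_cylinderPoly, Finset.mul_sum]
  simp only [Phi]
  rw [Finset.sum_comm]
  refine Finset.sum_congr rfl fun k hk => ?_
  rw [← Finset.sum_mul, (hP k).sum_kernelDt hμ (by have := Finset.mem_range.1 hk; omega)]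
  ring

lemma partialSum_eq_integral {μ L : ℝ} {WL : ℝ → ℝ}
    (P : (k : ℕ) → Fin (k + 1) → MvPolynomial (Fin 2) ℝ) (p : ℕ → Polynomial ℝ)
    {f : ℝ × ℝ × ℝ → ℝ}
    (hf : IntegrableOn (fun q => f q * cylinderWeight μ WL q) (cylinder L))
    (n : ℕ) (x : ℝ × ℝ × ℝ) :
    partialSum μ L WL P p n f x = a μ * ∫ q in cylinder L, f q * cylinderWeight μ WL q *
      ∑ l ∈ Finset.range (n + 1), ∑ k ∈ Finset.range (l + 1), ∑ j : Fin (k + 1),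
        cylinderPoly P p l k j q * cylinderPoly P p l k j x := by
  have hi (l k : ℕ) (j : Fin (k + 1)) : IntegrableOn (fun q => f q * cylinderWeight μ WL q *
      (cylinderPoly P p l k j q * cylinderPoly P p l k j x)) (cylinder L) :=
    hf.mul_continuousOn ((continuous_cylinderPoly P p l k j).mul continuous_const).continuousOn
      (isCompact_cylinder L)
  simp only [Finset.mul_sum]
  rw [integral_finsetSum _ fun l _ => integrable_finsetSum _ fun k _ =>
    integrable_finsetSum _ fun j _ => hi l k j, partialSum, Finset.mul_sum]
  refine Finset.sum_congr rfl fun l _ => ?_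
  rw [integral_finsetSum _ fun k _ => integrable_finsetSum _ fun j _ => hi l k j, Finset.mul_sum]
  refine Finset.sum_congr rfl fun k _ => ?_
  rw [integral_finsetSum _ fun j _ => hi l k j, Finset.mul_sum]
  refine Finset.sum_congr rfl fun j _ => ?_
  rw [fourierCoeff, mul_assoc, ← integral_mul_const]
  congr 2; ext q; ring

end CylinderRadon

end

theorem theorem5p2 (μ L : ℝ) (hμ : 0 ≤ μ) (hL : 0 < L)
    (WL : ℝ → ℝ) (hWL : CylinderRadon.IsWeight L WL)
    (P : (k : ℕ) → Fin (k + 1) → MvPolynomial (Fin 2) ℝ)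
    (hP : ∀ k, CylinderRadon.IsOrthonormalBasis μ k (P k))
    (p : ℕ → Polynomial ℝ) (hp : CylinderRadon.IsOrthonormalPolys L WL p)
    (f : ℝ × ℝ × ℝ → ℝ) (hf : MemLp f 2 (CylinderRadon.cylinderMeasure μ L WL))
    (n : ℕ) (x : ℝ × ℝ × ℝ) :
    CylinderRadon.partialSum μ L WL P p n f x =
      1 / ((n : ℝ) + 1) * ∑ ν ∈ Finset.range (n + 1),
        CylinderRadon.a μ * ∫ t in (-1 : ℝ)..1, ∫ w in (0 : ℝ)..L,
          CylinderRadon.radon μ (CylinderRadon.angle n ν) (fun q => f (q.1, q.2, w)) t *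
            CylinderRadon.Phi μ p n (CylinderRadon.angle n ν) w t x * WL w := by
  have hfW := CylinderRadon.integrableOn_mul_cylinderWeight hμ hWL hf
  have hi (ν : ℕ) := hfW.mul_continuousOn
    (CylinderRadon.continuous_Phi μ p n (CylinderRadon.angle n ν) x).continuousOn
    (CylinderRadon.isCompact_cylinder L)
  have h1 (ν : ℕ) := CylinderRadon.integral_radon μ (CylinderRadon.angle n ν) L hL.le WL f
    (fun w t => CylinderRadon.Phi μ p n (CylinderRadon.angle n ν) w t x) (hi ν)
  simp only [h1]
  -- With every Radon integral rewritten over the same cylinder, the sum over angles moves under a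
  -- single integral, where `sum_Phi` applies.
  rw [← Finset.mul_sum, ← integral_finsetSum _ fun ν _ => hi ν,
    CylinderRadon.partialSum_eq_integral P p hfW]
  simp only [← Finset.mul_sum, CylinderRadon.sum_Phi hμ hP]
  rw [mul_left_comm, ← integral_const_mul (1 / ((n : ℝ) + 1))]
  congr 1
  refine setIntegral_congr_fun (CylinderRadon.measurableSet_cylinder L) fun q _ => ?_
  have hn : (n : ℝ) + 1 ≠ 0 := by positivity
  field_simp
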